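/- Let $G$ be a finite simple graph. A pebble distribution is a function $P:V(G)\to\mathbb{Z}_{\ge 0}$; its size is $|P|=\sum_v P(v)$. A pebbling move removes two pebbles from a vertex $u$ with at least two pebbles and adds one pebble to a neighbour of $u$. A vertex $v$ is $k$-reachable under $P$ if some sequence of pebbling moves leads from $P$ to a distribution with at least $k$ pebbles on $v$; it is reachable if it is $1$-reachable. $P$ is solvable if every vertex is reachable under $P$, and optimal if it is solvable of minimal size among solvable distributions; the optimal pebbling number $\pi_{\mathrm{opt}}(G)$ is the minimal size of a solvable distribution. Let $\mathrm{cov}(P)$ be the number of vertices reachable under $P$. The excess of $v$ under $P$ is the greatest $k$ such that $v$ is $k$-reachable, minus $1$, if $v$ is reachable, and $0$ otherwise; $\mathrm{TE}(P)$ is the sum of the excesses of all vertices. A unit is a distribution with pebbles on exactly one vertex. The unit excess is $\mathrm{UE}(P)=\sum_{u:\,P(u)>0}\mathrm{TE}(P_u)$, where $P_u$ is the unit with $P(u)$ pebbles at $u$. Let $N_i(v)$ be the set of vertices at distance exactly $i$ from $v$, let $\mathrm{ef}(v)=\sum_{i=0}^{\mathrm{diam}(G)}2^{-i}|N_i(v)|$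 (with $\mathrm{diam}(G)=\infty$ if $G$ is disconnected), and let $\Delta$ be the maximum degree of $G$. **Corollary.** Let $G$ be a finite vertex-transitive graph with $\Delta\ne 2$, let $P$ be a solvable distribution on $G$, and let $U_1,\dots,U_t$ be pairwise disjoint units (no vertex has pebbles under two of them) with $P=U_1+\dots+U_t$. Then for every vertex $v$ $$|P|\;\ge\; B(P):=\frac{\frac{\Delta-1}{\Delta-2}\,|V(G)|+\mathrm{UE}(P)-\frac{1}{\Delta-2}\sum_{i=1}^t\mathrm{cov}(U_i)}{\mathrm{ef}(v)} .$$ In particular, if $P$ is optimal, then $\pi_{\mathrm{opt}}(G)\ge B(P)$. The terms of the bound are explicit: if the pebbles of $U_i$ are on the vertex $u$, then $\mathrm{cov}(U_i)=\sum_{k=0}^{\lfloor\log_2 U_i(u)\rfloor}|N_k(u)|$, and $$\mathrm{UE}(P)=\sum_{u:\,P(u)>0}\ \sum_{k=0}^{\lfloor\log_2 P(u)\rfloor}|N_k(u)|\left(\left\lfloor \frac{P(u)}{2^k}\right\rfloor-1\right).$$ -/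

import Mathlib

namespace Pebbling

variable {V : Type*}

/-- `P'` arises from the pebble distribution `P` by one pebbling move from a vertex `u`, which loses
two pebbles, to a neighbour `w`, which gains one. -/
def Move (G : SimpleGraph V) (P P' : V → ℕ) : Prop :=
  ∃ u w, G.Adj u w ∧ P' u + 2 = P u ∧ P' w = P w + 1 ∧ ∀ x, x ≠ u → x ≠ w → P' x = P x

/-- `P'` arises from `P` by an executable sequence of pebbling moves (possibly empty). -/
def Moves (G : SimpleGraph V) : (V → ℕ) → (V → ℕ) → Prop :=
  Relation.ReflTransGen (Move G)

/-- The vertex `v` is `k`-reachable under `P`. -/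
def KReachable (G : SimpleGraph V) (P : V → ℕ) (k : ℕ) (v : V) : Prop :=
  ∃ P', Moves G P P' ∧ k ≤ P' v

/-- The vertex `v` is reachable under `P`. -/
def Reachable (G : SimpleGraph V) (P : V → ℕ) (v : V) : Prop :=
  KReachable G P 1 v

/-- The distribution `P` is solvable: all vertices are reachable. -/
def Solvable (G : SimpleGraph V) (P : V → ℕ) : Prop :=
  ∀ v, Reachable G P v

/-- The size `|P|`, the total number of pebbles. -/
def size [Fintype V] (P : V → ℕ) : ℕ :=
  ∑ v, P v

/-- The distribution `P` is optimal: solvable and of minimal size among solvable distributions. -/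
def IsOptimal [Fintype V] (G : SimpleGraph V) (P : V → ℕ) : Prop :=
  Solvable G P ∧ ∀ Q, Solvable G Q → size P ≤ size Q

/-- The optimal pebbling number of `G`. The set is nonempty, since one pebble on each vertex is a
solvable distribution. -/
noncomputable def optimalPebblingNumber [Fintype V] (G : SimpleGraph V) : ℕ :=
  sInf {m | ∃ P, Solvable G P ∧ size P = m}

/-- The greatest `k` such that `v` is `k`-reachable under `P`. -/
noncomputable def reach (G : SimpleGraph V) (P : V → ℕ) (v : V) : ℕ :=
  sSup {k | KReachable G P k v}

theorem size_le_of_move [Fintype V] {G : SimpleGraph V} {P P' : V → ℕ} (h : Move G P P') :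
    size P' ≤ size P := by
  classical
  obtain ⟨u, w, huw, h1, h2, h3⟩ := h
  have hne : w ≠ u := huw.ne'
  have key : ∀ Q : V → ℕ, size Q = Q u + (Q w + ∑ x ∈ (Finset.univ.erase u).erase w, Q x) := by
    intro Q
    rw [Finset.add_sum_erase _ _ (by simp [hne]), Finset.add_sum_erase _ _ (by simp)]
    rfl
  have hs : ∑ x ∈ (Finset.univ.erase u).erase w, P' x
      = ∑ x ∈ (Finset.univ.erase u).erase w, P x := by
    refine Finset.sum_congr rfl fun x hx => ?_
    simp only [Finset.mem_erase] at hx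
    exact h3 x hx.2.1 hx.1
  rw [key P, key P', hs]
  omega

/-- The supremum in `reach` is attained on a finite graph. -/
theorem isGreatest_reach [Fintype V] (G : SimpleGraph V) (P : V → ℕ) (v : V) :
    IsGreatest {k | KReachable G P k v} (reach G P v) := by
  have hb : BddAbove {k | KReachable G P k v} := by
    refine ⟨size P, ?_⟩
    rintro k ⟨P', hP', hk⟩
    have hle : size P' ≤ size P := by
      clear hk
      induction hP' with
      | refl => exact le_rfl
      | tail _ hm ih => exact (size_le_of_move hm).trans ih
    exact (hk.trans (Finset.single_le_sum (fun _ _ => Nat.zero_le _) (Finset.mem_univ v))).trans hle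
  exact ⟨Nat.sSup_mem ⟨0, P, Relation.ReflTransGen.refl, Nat.zero_le _⟩ hb,
    fun k hk => le_csSup hb hk⟩

/-- The excess of `v` under `P`: it is `reach - 1` if `v` is reachable, and `0` otherwise (then
`reach` is `0` and the subtraction of natural numbers truncates). -/
noncomputable def excess (G : SimpleGraph V) (P : V → ℕ) (v : V) : ℕ :=
  reach G P v - 1

/-- The total excess `TE(P)`. -/
noncomputable def totalExcess [Fintype V] (G : SimpleGraph V) (P : V → ℕ) : ℕ :=
  ∑ v, excess G P v

open Classical in
/-- The unit excess `UE(P)`: the sum, over the vertices `u` with `P u > 0`, of the total excess of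
the distribution that has `P u` pebbles at `u` and none elsewhere. -/
noncomputable def unitExcess [Fintype V] (G : SimpleGraph V) (P : V → ℕ) : ℕ :=
  ∑ u with 0 < P u, totalExcess G (Pi.single u (P u))

/-- `cov(P)`, the number of vertices that are reachable under `P`. -/
noncomputable def cov (G : SimpleGraph V) (P : V → ℕ) : ℕ :=
  {v | Reachable G P v}.ncard

/-- `U` is a unit: exactly one vertex has pebbles under `U`. -/
def IsUnitDistribution (U : V → ℕ) : Prop :=
  ∃! u, 0 < U u

/-- `U 0, …, U (t - 1)` is a disjoint decomposition of `P` into units. -/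
structure IsUnitDecomposition (P : V → ℕ) {t : ℕ} (U : Fin t → V → ℕ) : Prop where
  isUnit : ∀ i, IsUnitDistribution (U i)
  disjoint : ∀ i j, i ≠ j → ∀ v, U i v = 0 ∨ U j v = 0
  sum_eq : ∑ i, U i = P

/-- `N_k(v)`, the set of the vertices at distance exactly `k` from `v`. -/
def sphere (G : SimpleGraph V) (k : ℕ) (v : V) : Set V :=
  {u | G.edist v u = k}

/-- The effect `ef(v) = ∑_{i = 0}^{diam G} (1/2)^i |N_i(v)|` of a pebble placed at `v`. The diameter
of a disconnected graph is infinite; as `N_i(v)` is empty for large `i` in a finite graph, the sum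
has finitely many nonzero terms in any case. -/
noncomputable def effect (G : SimpleGraph V) (v : V) : ℝ :=
  ∑ᶠ (i : ℕ) (_ : (i : ℕ∞) ≤ G.ediam), (1 / 2 : ℝ) ^ i * ((sphere G i v).ncard : ℝ)

/-- The effect on a finite connected graph as an ordinary sum up to the diameter. -/
theorem effect_eq_sum [Finite V] (G : SimpleGraph V) (hG : G.Connected) (v : V) :
    effect G v = ∑ i ∈ Finset.range (G.diam + 1), (1 / 2 : ℝ) ^ i * ((sphere G i v).ncard : ℝ) := by
  have := hG.nonempty
  have htop : G.ediam ≠ ⊤ := SimpleGraph.connected_iff_ediam_ne_top.mp hG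
  have hd : ((G.diam : ℕ) : ℕ∞) = G.ediam := ENat.natCast_toNat htop
  rw [effect, ← finsum_mem_coe_finset]
  refine finsum_congr fun i => ?_
  have : (i : ℕ∞) ≤ G.ediam ↔ i ∈ (Finset.range (G.diam + 1) : Set ℕ) := by
    rw [← hd]; simp
  simp only [this]

/-- Any vertex is mapped to any other one by an automorphism of the graph. -/
def VertexTransitive (G : SimpleGraph V) : Prop :=
  ∀ v₁ v₂ : V, ∃ f : G ≃g G, f v₁ = v₂

/-- The lower bound `(((Δ - 1) / (Δ - 2)) |V| + UE(P) - (1 / (Δ - 2)) ∑ᵢ cov(U i)) / ef(v)`, where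
`Δ` is the maximum degree. -/
noncomputable def excessBound [Fintype V] (G : SimpleGraph V) [DecidableRel G.Adj]
    (P : V → ℕ) {t : ℕ} (U : Fin t → V → ℕ) (v : V) : ℝ :=
  (((G.maxDegree : ℝ) - 1) / ((G.maxDegree : ℝ) - 2) * (Fintype.card V : ℝ)
      + (unitExcess G P : ℝ)
      - 1 / ((G.maxDegree : ℝ) - 2) * ∑ i, (cov G (U i) : ℝ)) / effect G v

end Pebbling

set_option linter.unusedSectionVars false

/-! Relax sequences of moves to flows, multisets of moves whose order is forgotten, and let R(v) =
`flowMax` be the most pebbles that a flow leaves on v. Give a pebble on a the weight 2^(-dist(a,v))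
for v. No move raises the total weight, so R(v) is at most the weight of P for v. By
vertex-transitivity ef is constant, and summing over v gives ∑ R(v) ≤ |P| ef. It remains to bound
the numerator by ∑ R(v) (`numerator_le_sum_flowMax`).

Let e(v) be the sum of the excesses of v under the units and m(v) the number of units that reach v.
The graph is regular; if Δ = d + 3, the claim reads ∑ ((d+1)(R - 1 - e) + m - 1) ≥ 0
(`sum_excess_flow`), and it is proved by discharging. The summand is negative, namely -1, only at
untouched vertices, where R = 1 and e = m = 0. Each of these has a neighbour that gains, that is, R
= e + 2 + g with g ≥ 0; the charge there is d + (d+1)g + m. Paying 1 to all d + 3 neighbours would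
overdraw this charge by 3 - m - (d+1)g. The gap is closed by the neighbours that supply u: they are
touched and usually cost nothing, and when they are too few, u also collects `demand` from them. The
local balance is `discharge`.

The danger is that neighbours demand from each other. A supplier of v obtains its pebbles by
strictly fewer moves than v needs to gain, so minimality of `gainCost` excludes circular dependence
(`not_mem_suppliers`, `not_all_supplied`). In the cases that escape this argument, pebbles of a unit
add to those supplied and force g to be large enough to pay. -/

namespace Pebbling

variable {V : Type*}

/-! ### Flows as unordered pebbling moves -/

/-- A multiset of pebbling moves, `f x y` of them from `x` to `y`, in which no vertex gives away more
pebbles than it has and receives. The moves need not be executable in some order. -/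
structure IsFlow [Fintype V] (G : SimpleGraph V) (P : V → ℕ) (f : V → V → ℕ) : Prop where
  adj : ∀ x y, f x y ≠ 0 → G.Adj x y
  balanced : ∀ v, 2 * ∑ y, f v y ≤ P v + ∑ x, f x v

/-- The flow `f` leaves at least `k` pebbles on `v`. -/
def Leaves [Fintype V] (P : V → ℕ) (f : V → V → ℕ) (k : ℕ) (v : V) : Prop :=
  2 * ∑ y, f v y + k ≤ P v + ∑ x, f x v

/-- The number of moves of a flow. -/
def flowCost [Fintype V] (f : V → V → ℕ) : ℕ := ∑ x, ∑ y, f x y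

/-- Some flow with at most `c` moves leaves at least `k` pebbles on `v`. -/
def FlowReach [Fintype V] (G : SimpleGraph V) (P : V → ℕ) (c k : ℕ) (v : V) : Prop :=
  ∃ f, IsFlow G P f ∧ flowCost f ≤ c ∧ Leaves P f k v

/-- The flow that consists of `n` moves from `x` to `y`. -/
def edgeFlow [DecidableEq V] (n : ℕ) (x y : V) : V → V → ℕ :=
  fun p q => if p = x ∧ q = y then n else 0

section

variable [Fintype V] [DecidableEq V] {G : SimpleGraph V} {P : V → ℕ}

theorem sum_edgeFlow_left (n : ℕ) (x y p : V) :
    ∑ q, edgeFlow n x y p q = if p = x then n else 0 := by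
  by_cases h : p = x <;> simp [edgeFlow, h]

theorem sum_edgeFlow_right (n : ℕ) (x y q : V) :
    ∑ p, edgeFlow n x y p q = if q = y then n else 0 := by
  by_cases h : q = y <;> simp [edgeFlow, h]

theorem flowCost_edgeFlow (n : ℕ) (x y : V) : flowCost (edgeFlow n x y) = n := by
  simp [flowCost, sum_edgeFlow_left]

theorem flowCost_add (f g : V → V → ℕ) : flowCost (f + g) = flowCost f + flowCost g := by
  simp [flowCost, Finset.sum_add_distrib]

theorem exists_eq_add_edgeFlow {f : V → V → ℕ} {x y : V} (h : f x y ≠ 0) :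
    ∃ g, f = g + edgeFlow 1 x y := by
  refine ⟨fun p q => f p q - edgeFlow 1 x y p q, ?_⟩
  funext p q
  by_cases hpq : p = x ∧ q = y
  · obtain ⟨rfl, rfl⟩ := hpq
    simp [edgeFlow]; omega
  · simp [edgeFlow, hpq]

/-- Losing one pebble costs at most one pebble at `v`. If `y` can no longer afford its moves, drop
one move from `y` to some `z`: this restores `y`, and `z` now lacks one pebble. The deficit travels
along a shrinking flow until some vertex absorbs it. -/
theorem exists_le_flow_of_remove_pebble {k : ℕ} {v : V} (n : ℕ) :
    ∀ (f : V → V → ℕ) (y : V), flowCost f = n →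
      IsFlow G (fun x => P x + if x = y then 1 else 0) f →
      Leaves (fun x => P x + if x = y then 1 else 0) f (k + 1) v →
      ∃ g, g ≤ f ∧ IsFlow G P g ∧ Leaves P g k v := by
  induction n with
  | zero =>
    intro f y hn hf hl
    have h0 : ∀ p q, f p q = 0 := by
      simpa [flowCost] using hn
    refine ⟨f, le_rfl, ⟨hf.adj, by simp [h0]⟩, ?_⟩
    unfold Leaves at *
    simp only [h0, Finset.sum_const_zero] at *
    split_ifs at hl <;> omega
  | succ n ih =>
    intro f y hn hf hl
    by_cases hb : 2 * ∑ z, f y z ≤ P y + ∑ x, f x y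
    · refine ⟨f, le_rfl, ⟨hf.adj, fun w => ?_⟩, ?_⟩
      · by_cases hw : w = y
        · subst hw; exact hb
        · simpa [hw] using hf.balanced w
      · unfold Leaves at *
        dsimp only at hl
        split_ifs at hl <;> omega
    · have hby := hf.balanced y
      simp only [if_true] at hby
      have hpos : ∑ z, f y z ≠ 0 := by omega
      obtain ⟨z, -, hz⟩ := Finset.exists_ne_zero_of_sum_ne_zero hpos
      have hyz := hf.adj y z hz
      obtain ⟨f1, rfl⟩ := exists_eq_add_edgeFlow hz
      have hc : flowCost f1 = n := by
        rw [flowCost_add, flowCost_edgeFlow] at hn; omega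
      have hne := hyz.ne
      have hflow : IsFlow G (fun x => P x + if x = z then 1 else 0) f1 := by
        refine ⟨fun p q h => hf.adj p q (by simp only [Pi.add_apply]; omega), fun w => ?_⟩
        have hw := hf.balanced w
        simp only [Pi.add_apply, Finset.sum_add_distrib, sum_edgeFlow_left,
          sum_edgeFlow_right] at hw ⊢
        by_cases h1 : w = y
        · subst h1
          simp only [if_true, hne, if_false] at hw ⊢
          omega
        · simp only [h1, if_false] at hw ⊢; omega
      have hleaves : Leaves (fun x => P x + if x = z then 1 else 0) f1 (k + 1) v := by
        unfold Leaves at *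
        simp only [Pi.add_apply, Finset.sum_add_distrib, sum_edgeFlow_left,
          sum_edgeFlow_right] at hb hby hl ⊢
        by_cases h1 : v = y
        · subst h1
          simp only [if_true, hne, if_false] at hl hb ⊢
          omega
        · simp only [h1, if_false] at hl ⊢; omega
      obtain ⟨g, hg, h1, h2⟩ := ih f1 z hc hflow hleaves
      exact ⟨g, hg.trans (fun p q => by simp), h1, h2⟩

/-- A flow contains one that leaves as many pebbles on `v` and has no move out of `v`. -/
theorem IsFlow.exists_le_no_out {k : ℕ} {v : V} {f : V → V → ℕ} (hf : IsFlow G P f)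
    (hl : Leaves P f k v) :
    ∃ g, g ≤ f ∧ IsFlow G P g ∧ Leaves P g k v ∧ ∀ y, g v y = 0 := by
  induction hn : flowCost f using Nat.strong_induction_on generalizing f with
  | _ n ih =>
  by_cases h0 : ∀ y, f v y = 0
  · exact ⟨f, le_rfl, hf, hl, h0⟩
  push Not at h0
  obtain ⟨y, hy⟩ := h0
  have hvy := hf.adj v y hy
  obtain ⟨f1, rfl⟩ := exists_eq_add_edgeFlow hy
  -- Dropping a move from `v` to `y` saves two pebbles at `v` and takes one from `y`; repairing the
  -- loss at `y` costs at most one at `v`.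
  obtain ⟨g, hg, h1, h2⟩ := exists_le_flow_of_remove_pebble (k := k) (v := v) (P := P) (G := G)
    _ f1 y rfl ⟨fun p q h => hf.adj p q (by simp only [Pi.add_apply]; omega), fun w => by
      have hw := hf.balanced w
      simp only [Pi.add_apply, Finset.sum_add_distrib, sum_edgeFlow_left,
          sum_edgeFlow_right] at hw ⊢
      omega⟩ (by
      unfold Leaves at *
      simp only [Pi.add_apply, Finset.sum_add_distrib, sum_edgeFlow_left,
          sum_edgeFlow_right] at hl ⊢
      simp only [if_true] at hl ⊢
      have := hvy.ne
      simp only [this, if_false] at hl ⊢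
      omega)
  have hlt : flowCost g < n := by
    have : flowCost g ≤ flowCost f1 :=
      Finset.sum_le_sum fun p _ => Finset.sum_le_sum fun q _ => hg p q
    rw [flowCost_add, flowCost_edgeFlow] at hn
    omega
  obtain ⟨g', hg', h⟩ := ih _ hlt h1 h2 rfl
  exact ⟨g', hg'.trans (hg.trans fun p q => by simp), h⟩

/-- The flow `f` without its moves into `v`. -/
def clearIn (f : V → V → ℕ) (v : V) : V → V → ℕ := fun x y => if y = v then 0 else f x y

theorem clearIn_le (f : V → V → ℕ) (v : V) : clearIn f v ≤ f := fun x y => by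
  by_cases h : y = v <;> simp [clearIn, h]

theorem sum_clearIn_left (f : V → V → ℕ) (v x : V) :
    ∑ y, clearIn f v x y + f x v = ∑ y, f x y := by
  rw [← Finset.add_sum_erase _ (fun y => f x y) (Finset.mem_univ v),
    ← Finset.add_sum_erase _ (fun y => clearIn f v x y) (Finset.mem_univ v)]
  have : ∑ y ∈ Finset.univ.erase v, clearIn f v x y = ∑ y ∈ Finset.univ.erase v, f x y :=
    Finset.sum_congr rfl fun y hy => by simp [clearIn, Finset.ne_of_mem_erase hy]
  rw [this]
  simp [clearIn, add_comm]

theorem sum_clearIn_right (f : V → V → ℕ) (v y : V) :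
    ∑ x, clearIn f v x y = if y = v then 0 else ∑ x, f x y := by
  by_cases h : y = v <;> simp [clearIn, h]

theorem flowCost_clearIn (f : V → V → ℕ) (v : V) :
    flowCost (clearIn f v) + ∑ x, f x v = flowCost f := by
  simp only [flowCost, ← Finset.sum_add_distrib, sum_clearIn_left]

theorem IsFlow.clearIn {f : V → V → ℕ} (hf : IsFlow G P f) {v : V} (hv : ∀ y, f v y = 0) :
    IsFlow G P (clearIn f v) := by
  refine ⟨fun x y h => hf.adj x y fun h0 => h ?_, fun w => ?_⟩
  · have : Pebbling.clearIn f v x y ≤ f x y := clearIn_le f v x y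
    omega
  · have h1 := sum_clearIn_left f v w
    have h2 := sum_clearIn_right f v w
    have h3 := hf.balanced w
    by_cases hw : w = v
    · subst hw
      simp [Pebbling.clearIn, hv]
    · simp only [hw, if_false] at h2
      omega

/-- Each deleted move from `x` to `v` saves the two pebbles that it would have cost `x`. -/
theorem IsFlow.leaves_clearIn {f : V → V → ℕ} (hf : IsFlow G P f) {v x : V} (hx : x ≠ v) :
    Leaves P (Pebbling.clearIn f v) (2 * f x v) x := by
  have h1 := sum_clearIn_left f v x
  have h2 := sum_clearIn_right f v x
  have h3 := hf.balanced x
  simp only [hx, if_false] at h2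
  unfold Leaves
  omega

theorem IsFlow.add {Q : V → ℕ} {f g : V → V → ℕ} (hf : IsFlow G P f) (hg : IsFlow G Q g) :
    IsFlow G (P + Q) (f + g) := by
  refine ⟨fun x y h => ?_, fun v => ?_⟩
  · by_cases h0 : f x y = 0
    · exact hg.adj x y fun h1 => h (by simp [h0, h1])
    · exact hf.adj x y h0
  · have := hf.balanced v
    have := hg.balanced v
    simp only [Pi.add_apply, Finset.sum_add_distrib]
    omega

theorem Leaves.add {Q : V → ℕ} {f g : V → V → ℕ} {k l : ℕ} {v : V} (hf : Leaves P f k v)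
    (hg : Leaves Q g l v) : Leaves (P + Q) (f + g) (k + l) v := by
  unfold Leaves at *
  simp only [Pi.add_apply, Finset.sum_add_distrib]
  omega

theorem FlowReach.add {Q : V → ℕ} {c d k l : ℕ} {v : V} (hf : FlowReach G P c k v)
    (hg : FlowReach G Q d l v) : FlowReach G (P + Q) (c + d) (k + l) v := by
  obtain ⟨f, h1, h2, h3⟩ := hf
  obtain ⟨g, h4, h5, h6⟩ := hg
  exact ⟨f + g, h1.add h4, by rw [flowCost_add]; omega, h3.add h6⟩

theorem FlowReach.mono {c d k l : ℕ} {v : V} (hf : FlowReach G P c k v) (hc : c ≤ d)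
    (hk : l ≤ k) : FlowReach G P d l v := by
  obtain ⟨f, h1, h2, h3⟩ := hf
  exact ⟨f, h1, h2.trans hc, by unfold Leaves at *; omega⟩

theorem flowReach_self (v : V) : FlowReach G P 0 (P v) v :=
  ⟨0, ⟨by simp, by simp⟩, by simp [flowCost], by simp [Leaves]⟩

/-- A flow that does not use the pebbles on `a` is a flow without them. -/
theorem IsFlow.update {f : V → V → ℕ} (hf : IsFlow G P f) {a : V} (ha : ∀ y, f a y = 0) :
    IsFlow G (Function.update P a 0) f := by
  refine ⟨hf.adj, fun v => ?_⟩
  by_cases h : v = a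
  · subst h; simp [ha]
  · simpa [h] using hf.balanced v

theorem update_add_single (a : V) : Function.update P a 0 + Pi.single a (P a) = P := by
  funext v
  by_cases h : v = a
  · subst h; simp
  · simp [h]

/-- Sum the balances over all vertices: every move costs two pebbles and yields one. -/
theorem Leaves.le_size {f : V → V → ℕ} (hf : IsFlow G P f) {k : ℕ} {v : V}
    (hl : Leaves P f k v) : k ≤ size P := by
  have h1 : ∑ w, (2 * ∑ y, f w y + if w = v then k else 0) ≤ ∑ w, (P w + ∑ x, f x w) := by
    refine Finset.sum_le_sum fun w _ => ?_
    by_cases h : w = v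
    · subst h; simpa [Leaves] using hl
    · simpa [h] using hf.balanced w
  have h2 : ∑ w, ∑ x, f x w = ∑ w, ∑ y, f w y := Finset.sum_comm
  simp only [Finset.sum_add_distrib, ← Finset.mul_sum, Finset.sum_ite_eq', Finset.mem_univ,
    if_true, h2] at h1
  unfold size
  omega

/-- The greatest number of pebbles that a flow leaves on `v`. -/
noncomputable def flowMax (G : SimpleGraph V) (P : V → ℕ) (v : V) : ℕ :=
  sSup {k | ∃ c, FlowReach G P c k v}

theorem le_flowMax_iff {k : ℕ} {v : V} : k ≤ flowMax G P v ↔ ∃ c, FlowReach G P c k v := by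
  have hb : BddAbove {k | ∃ c, FlowReach G P c k v} := by
    refine ⟨size P, ?_⟩
    rintro k ⟨c, f, h1, -, h2⟩
    exact h2.le_size h1
  constructor
  · intro h
    obtain ⟨c, hc⟩ := Nat.sSup_mem (s := {k | ∃ c, FlowReach G P c k v})
      ⟨P v, 0, flowReach_self v⟩ hb
    exact ⟨c, hc.mono le_rfl h⟩
  · exact fun h => le_csSup hb h

theorem FlowReach.le_flowMax {c k : ℕ} {v : V} (h : FlowReach G P c k v) :
    k ≤ flowMax G P v := le_flowMax_iff.2 ⟨c, h⟩

/-- If more than `P u` pebbles reach `u`, then neighbours `w` of `u` supply the missing pebbles. -/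
theorem FlowReach.exists_suppliers {c k : ℕ} {u : V} (h : FlowReach G P c k u) (hk : P u < k) :
    ∃ j : V → ℕ, k ≤ P u + ∑ w, j w ∧
      ∀ w, j w ≠ 0 → G.Adj w u ∧ ∃ c' < c, FlowReach G P c' (2 * j w) w := by
  obtain ⟨f, h1, h2, h3⟩ := h
  obtain ⟨g, hg, h4, h5, h6⟩ := h1.exists_le_no_out h3
  have h7 : k ≤ P u + ∑ w, g w u := by unfold Leaves at h5; omega
  -- Deleting the moves into `u` removes at least the move from `w`, so the cost drops strictly. All
  -- later minimality arguments rest on this.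
  refine ⟨fun w => g w u, h7, fun w hw => ⟨h4.adj _ _ hw, flowCost (clearIn g u), ?_,
    clearIn g u, h4.clearIn h6, le_rfl, h4.leaves_clearIn (h4.adj _ _ hw).ne⟩⟩
  have h8 := flowCost_clearIn g u
  have h9 : flowCost g ≤ flowCost f :=
      Finset.sum_le_sum fun p _ => Finset.sum_le_sum fun q _ => hg p q
  omega

end

/-! ### The contribution of a single unit -/

open Classical in
/-- The number of pebbles that `v` can receive if only the pebbles on `a` are used. -/
noncomputable def unitReach (G : SimpleGraph V) (P : V → ℕ) (a v : V) : ℕ :=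
  if G.Reachable a v then P a / 2 ^ G.dist a v else 0

theorem unitReach_self (G : SimpleGraph V) (P : V → ℕ) (a : V) : unitReach G P a a = P a := by
  simp [unitReach]

theorem unitReach_le_of_adj {G : SimpleGraph V} (P : V → ℕ) (a : V) {x y : V} (h : G.Adj x y) :
    unitReach G P a x ≤ 2 * unitReach G P a y + 1 := by
  unfold unitReach
  by_cases hx : G.Reachable a x
  · have hy : G.Reachable a y := hx.trans h.reachable
    have hd : G.dist a y ≤ G.dist a x + 1 := by
      have := h.diff_dist_adj (u := a)
      omega
    have h1 : P a / 2 ^ (G.dist a x + 1) ≤ P a / 2 ^ G.dist a y :=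
      Nat.div_le_div_left (Nat.pow_le_pow_right (by norm_num) hd) (by positivity)
    rw [pow_succ, ← Nat.div_div_eq_div_mul] at h1
    simp only [hx, hy, if_true]
    omega
  · simp [hx]

theorem exists_adj_dist_add_one {G : SimpleGraph V} {a v : V} (h : G.Reachable a v) (hne : v ≠ a) :
    ∃ x, G.Adj x v ∧ G.Reachable a x ∧ G.dist a v = G.dist a x + 1 := by
  obtain ⟨p, hp⟩ := h.symm.exists_walk_length_eq_dist
  cases p with
  | nil => exact absurd rfl hne
  | @cons _ x _ hadj q =>
    refine ⟨x, hadj.symm, q.reachable.symm, ?_⟩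
    have h1 := SimpleGraph.dist_le q
    have h2 := hadj.diff_dist_adj (u := a)
    rw [SimpleGraph.Walk.length_cons] at hp
    rw [SimpleGraph.dist_comm] at h1 hp
    omega

theorem exists_adj_unitReach_eq_div_two {G : SimpleGraph V} {P : V → ℕ} {a v : V}
    (h : 1 ≤ unitReach G P a v) (hne : v ≠ a) :
    ∃ x, G.Adj x v ∧ unitReach G P a v = unitReach G P a x / 2 := by
  have hr : G.Reachable a v := by
    by_contra h0
    simp [unitReach, h0] at h
  obtain ⟨x, hx, hax, hd⟩ := exists_adj_dist_add_one hr hne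
  refine ⟨x, hx, ?_⟩
  simp only [unitReach, hr, hax, if_true, hd, pow_succ, Nat.div_div_eq_div_mul]

section

variable [Fintype V] [DecidableEq V] {G : SimpleGraph V} {P : V → ℕ}

theorem FlowReach.half {c k : ℕ} {x v : V} (h : FlowReach G P c k x) (hxv : G.Adj x v) :
    FlowReach G P (c + k / 2) (k / 2) v := by
  obtain ⟨f, h1, h2, h3⟩ := h
  have hne := hxv.ne
  refine ⟨f + edgeFlow (k / 2) x v, ⟨fun p q h => ?_, fun w => ?_⟩, ?_, ?_⟩
  · by_cases h0 : p = x ∧ q = v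
    · rw [h0.1, h0.2]; exact hxv
    · exact h1.adj p q (by simpa [edgeFlow, h0] using h)
  · have := h1.balanced w
    unfold Leaves at h3
    simp only [Pi.add_apply, Finset.sum_add_distrib, sum_edgeFlow_left, sum_edgeFlow_right]
    by_cases hw : w = x
    · subst hw; simp only [if_true]; omega
    · simp only [hw, if_false]; omega
  · rw [flowCost_add, flowCost_edgeFlow]; omega
  · have := h1.balanced v
    unfold Leaves at *
    simp only [Pi.add_apply, Finset.sum_add_distrib, sum_edgeFlow_left, sum_edgeFlow_right,
      if_true, hne.symm, if_false]
    omega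

theorem exists_flowReach_unitReach (G : SimpleGraph V) (P : V → ℕ) (a v : V) :
    ∃ c, FlowReach G (Pi.single a (P a)) c (unitReach G P a v) v := by
  by_cases hr : G.Reachable a v
  · simp only [unitReach, hr, if_true]
    induction hn : G.dist a v generalizing v with
    | zero =>
      rw [hr.dist_eq_zero_iff] at hn
      subst hn
      exact ⟨0, by simpa using flowReach_self (G := G) (P := Pi.single a (P a)) a⟩
    | succ n ih =>
      have hne : v ≠ a := by rintro rfl; simp at hn
      obtain ⟨x, hx, hax, hd⟩ := exists_adj_dist_add_one hr hne
      obtain ⟨c, hc⟩ := ih x hax (by omega)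
      refine ⟨_, (hc.half hx).mono le_rfl ?_⟩
      rw [pow_succ, Nat.div_div_eq_div_mul]
  · exact ⟨0, by simpa [unitReach, hr] using (flowReach_self v).mono le_rfl (Nat.zero_le _)⟩

/-- Flows that start from different units can be superposed. -/
theorem sum_unitReach_le_flowMax (v : V) : ∑ a, unitReach G P a v ≤ flowMax G P v := by
  have key : ∀ s : Finset V, ∃ c, FlowReach G (∑ a ∈ s, Pi.single a (P a)) c
      (∑ a ∈ s, unitReach G P a v) v := by
    intro s
    induction s using Finset.induction_on with
    | empty => exact ⟨0, (flowReach_self v).mono le_rfl (by simp)⟩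
    | insert a s ha ih =>
      obtain ⟨c, hc⟩ := ih
      obtain ⟨d, hd⟩ := exists_flowReach_unitReach G P a v
      rw [Finset.sum_insert ha, Finset.sum_insert ha]
      exact ⟨_, hd.add hc⟩
  have h := key Finset.univ
  rw [Finset.univ_sum_single] at h
  exact le_flowMax_iff.2 h

/-- Pebbles that reach `x` without the pebbles of `a` add up with those that `a` sends to `x`. -/
theorem add_unitReach_le_flowMax {f : V → V → ℕ} {k : ℕ} {a x : V} (hf : IsFlow G P f)
    (ha : ∀ y, f a y = 0) (hl : Leaves P f k x) (hx : x ≠ a) :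
    k + unitReach G P a x ≤ flowMax G P x := by
  have h1 : FlowReach G (Function.update P a 0) (flowCost f) k x :=
    ⟨f, hf.update ha, le_rfl, by simpa [Leaves, hx] using hl⟩
  obtain ⟨d, hd⟩ := exists_flowReach_unitReach G P a x
  have h2 := h1.add hd
  rw [update_add_single] at h2
  exact h2.le_flowMax

/-- If `x` sends `f x v` pebbles to `v`, it may keep them and receive pebbles from `v` instead. -/
theorem IsFlow.le_flowMax_of_reverse {f : V → V → ℕ} (hf : IsFlow G P f) {k : ℕ} {v x : V}
    (hv : ∀ y, f v y = 0) (hl : Leaves P f k v) (hx : f x v ≠ 0) :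
    2 * f x v + (k - f x v) / 2 ≤ flowMax G P x := by
  have hxv := hf.adj _ _ hx
  have hne := hxv.ne
  obtain ⟨g, hg⟩ : ∃ g, f = g + edgeFlow (f x v) x v := by
    refine ⟨fun p q => f p q - edgeFlow (f x v) x v p q, ?_⟩
    funext p q
    by_cases hpq : p = x ∧ q = v
    · simp [edgeFlow, hpq]
    · simp [edgeFlow, hpq]
  generalize f x v = j at *
  subst hg
  -- Undoing the `j` moves from `x` to `v` returns `2 * j` pebbles to `x` and leaves `k - j` on `v`;
  -- half of these are then moved to `x`.
  refine FlowReach.le_flowMax (c := flowCost (g + edgeFlow ((k - j) / 2) v x))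
    ⟨g + edgeFlow ((k - j) / 2) v x, ⟨fun p q h => ?_, fun w => ?_⟩, le_rfl, ?_⟩
  · by_cases h0 : p = v ∧ q = x
    · rw [h0.1, h0.2]; exact hxv.symm
    · have : g p q ≠ 0 := by simpa [edgeFlow, h0] using h
      exact hf.adj p q (by simp only [Pi.add_apply]; omega)
  · have h1 := hf.balanced w
    have h2 := hf.balanced v
    have h4 : ∑ y, (g + edgeFlow j x v) v y = 0 := by simp only [hv, Finset.sum_const_zero]
    unfold Leaves at hl
    simp only [Pi.add_apply, Finset.sum_add_distrib, sum_edgeFlow_left, sum_edgeFlow_right,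
      if_true, hne.symm, if_false] at h1 h2 hl h4 ⊢
    by_cases hw : w = v
    · subst hw; simp only [if_true, hne.symm, if_false] at *; omega
    · by_cases hw' : w = x
      · subst hw'; simp only [if_true, hne, if_false] at *; omega
      · simp only [hw, hw', if_false] at *; omega
  · have h1 := hf.balanced x
    unfold Leaves at hl ⊢
    simp only [Pi.add_apply, Finset.sum_add_distrib, sum_edgeFlow_left, sum_edgeFlow_right,
      if_true, hne, hne.symm, if_false] at h1 hl ⊢
    omega

/-! ### Gaining vertices and their suppliers -/

/-- The number of units that reach `v`. -/
noncomputable def coverCount (G : SimpleGraph V) (P : V → ℕ) (v : V) : ℕ :=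
  (Finset.univ.filter fun a => 1 ≤ unitReach G P a v).card

/-- The sum of the excesses of `v` under the units of `P`. -/
noncomputable def sumExcess (G : SimpleGraph V) (P : V → ℕ) (v : V) : ℕ :=
  ∑ a, (unitReach G P a v - 1)

/-- The vertex `v` has a greater excess under flows than under the units together. -/
def Gains (G : SimpleGraph V) (P : V → ℕ) (v : V) : Prop :=
  sumExcess G P v + 2 ≤ flowMax G P v

/-- The least number of moves by which `v` gains. -/
noncomputable def gainCost (G : SimpleGraph V) (P : V → ℕ) (v : V) : ℕ :=
  sInf {c | FlowReach G P c (sumExcess G P v + 2) v}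

theorem gainCost_le {c k : ℕ} {v : V} (h : FlowReach G P c k v) (hk : sumExcess G P v + 2 ≤ k) :
    gainCost G P v ≤ c := Nat.sInf_le (h.mono le_rfl hk)

theorem Gains.exists_flow {v : V} (h : Gains G P v) :
    ∃ f, IsFlow G P f ∧ flowCost f ≤ gainCost G P v ∧ Leaves P f (sumExcess G P v + 2) v ∧
      ∀ y, f v y = 0 := by
  obtain ⟨f, h1, h2, h3⟩ := Nat.sInf_mem (le_flowMax_iff.1 h)
  obtain ⟨g, h4, h5, h6, h7⟩ := h1.exists_le_no_out h3
  exact ⟨g, h5, le_trans (Finset.sum_le_sum fun p _ => Finset.sum_le_sum fun q _ => h4 p q) h2,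
    h6, h7⟩

open Classical in
/-- A flow with the least number of moves by which `v` gains. -/
noncomputable def gainFlow (G : SimpleGraph V) (P : V → ℕ) (v : V) : V → V → ℕ :=
  if h : Gains G P v then h.exists_flow.choose else 0

theorem Gains.gainFlow_spec {v : V} (h : Gains G P v) :
    IsFlow G P (gainFlow G P v) ∧ flowCost (gainFlow G P v) ≤ gainCost G P v ∧
      Leaves P (gainFlow G P v) (sumExcess G P v + 2) v ∧ ∀ y, gainFlow G P v v y = 0 := by
  rw [gainFlow, dif_pos h]
  exact h.exists_flow.choose_spec

/-- The neighbours of `v` that send pebbles to `v` in `gainFlow`. -/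
noncomputable def suppliers (G : SimpleGraph V) (P : V → ℕ) (v : V) : Finset V :=
  Finset.univ.filter fun x => gainFlow G P v x v ≠ 0

theorem gains_of_mem_suppliers {v x : V} (hx : x ∈ suppliers G P v) : Gains G P v := by
  by_contra h
  simp [suppliers, gainFlow, h] at hx

theorem adj_of_mem_suppliers {v x : V} (hx : x ∈ suppliers G P v) : G.Adj x v := by
  have h := (gains_of_mem_suppliers hx).gainFlow_spec
  simp only [suppliers, Finset.mem_filter, Finset.mem_univ, true_and] at hx
  exact h.1.adj _ _ hx

/-- What a supplier sends to `v` reaches it by fewer moves that do not touch `v`. -/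
theorem exists_flow_of_mem_suppliers {v x : V} (hx : x ∈ suppliers G P v) :
    ∃ f, IsFlow G P f ∧ flowCost f < gainCost G P v ∧
      Leaves P f (2 * gainFlow G P v x v) x ∧ (∀ y, f v y = 0) ∧ ∀ y, f y v = 0 := by
  obtain ⟨h1, h2, h3, h4⟩ := (gains_of_mem_suppliers hx).gainFlow_spec
  have hxv := adj_of_mem_suppliers hx
  simp only [suppliers, Finset.mem_filter, Finset.mem_univ, true_and] at hx
  refine ⟨clearIn (gainFlow G P v) v, h1.clearIn h4, ?_, h1.leaves_clearIn hxv.ne,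
    fun y => ?_, fun y => by simp [clearIn]⟩
  · have h5 := flowCost_clearIn (gainFlow G P v) v
    have h6 := Finset.single_le_sum (f := fun w => gainFlow G P v w v) (fun _ _ => Nat.zero_le _)
      (Finset.mem_univ x)
    omega
  · have : clearIn (gainFlow G P v) v v y ≤ gainFlow G P v v y := clearIn_le _ _ _ _
    rw [h4] at this
    omega

theorem Gains.le_sum_suppliers {v : V} (h : Gains G P v) :
    sumExcess G P v + 2 ≤ P v + ∑ x ∈ suppliers G P v, gainFlow G P v x v := by
  obtain ⟨h1, h2, h3, h4⟩ := h.gainFlow_spec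
  unfold Leaves at h3
  rw [suppliers, Finset.sum_filter_ne_zero]
  omega

theorem flowReach_of_mem_suppliers {v x : V} (hx : x ∈ suppliers G P v) :
    ∃ c < gainCost G P v, FlowReach G P c 2 x := by
  obtain ⟨f, h1, h2, h3, -⟩ := exists_flow_of_mem_suppliers hx
  simp only [suppliers, Finset.mem_filter, Finset.mem_univ, true_and] at hx
  exact ⟨_, h2, f, h1, le_rfl, by unfold Leaves at *; omega⟩

/-- A sole supplier can get twice the number of pebbles that `v` lacks. -/
theorem flowReach_of_suppliers_eq {v x : V} (hx : suppliers G P v = {x}) :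
    ∃ c < gainCost G P v, FlowReach G P c (2 * (sumExcess G P v + 2 - P v)) x := by
  have hx' : x ∈ suppliers G P v := by simp [hx]
  obtain ⟨f, h1, h2, h3, -⟩ := exists_flow_of_mem_suppliers hx'
  have h4 := (gains_of_mem_suppliers hx').le_sum_suppliers
  rw [hx, Finset.sum_singleton] at h4
  exact ⟨_, h2, f, h1, le_rfl, by unfold Leaves at *; omega⟩

/-- The moves that serve `x` never use the pebbles on `v`, so what the unit at `v` sends to `x`
comes on top. -/
theorem add_two_le_flowMax_of_mem_suppliers {v x : V} (hx : x ∈ suppliers G P v) :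
    unitReach G P v x + 2 ≤ flowMax G P x := by
  obtain ⟨f, h1, -, h3, h4, -⟩ := exists_flow_of_mem_suppliers hx
  have hne := (adj_of_mem_suppliers hx).ne
  have := add_unitReach_le_flowMax h1 h4 h3 hne
  simp only [suppliers, Finset.mem_filter, Finset.mem_univ, true_and] at hx
  omega

/-- Reverse the supply. If `x` sends `j ≥ 1` pebbles, it can hold `2 * j + (𝐞 v + 2 - j) / 2`
instead, and `j = 1` is the worst case. -/
theorem sumExcess_add_four_le_of_mem_suppliers {v x : V} (hx : x ∈ suppliers G P v) :
    sumExcess G P v + 4 ≤ 2 * flowMax G P x := by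
  obtain ⟨h1, h2, h3, h4⟩ := (gains_of_mem_suppliers hx).gainFlow_spec
  simp only [suppliers, Finset.mem_filter, Finset.mem_univ, true_and] at hx
  have := h1.le_flowMax_of_reverse h4 h3 hx
  omega

/-- The sole supplier `u` of `a` is itself supplied by a vertex different from `a`. -/
theorem exists_supplier_of_suppliers_eq {a u : V} (hu : suppliers G P a = {u}) (hP : P u ≤ 1) :
    ∃ z, G.Adj z u ∧ z ≠ a ∧ unitReach G P a z + 2 ≤ flowMax G P z ∧
      ∃ c < gainCost G P a, FlowReach G P c 2 z := by
  have hu' : u ∈ suppliers G P a := by simp [hu]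
  obtain ⟨f, h1, h2, h3, h4, h5⟩ := exists_flow_of_mem_suppliers hu'
  simp only [suppliers, Finset.mem_filter, Finset.mem_univ, true_and] at hu'
  obtain ⟨g, hg, h6, h7, h8⟩ := h1.exists_le_no_out h3
  have hga : ∀ y, g a y = 0 := fun y => by
    have : g a y ≤ f a y := hg a y
    rw [h4] at this; omega
  -- At least two pebbles are left on `u`, which owns at most one. Since the flow does not leave
  -- `a`, the rest comes from elsewhere.
  have hpos : ∑ z, g z u ≠ 0 := by
    unfold Leaves at h7; omega
  obtain ⟨z, -, hz⟩ := Finset.exists_ne_zero_of_sum_ne_zero hpos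
  have hzu := h6.adj _ _ hz
  have hza : z ≠ a := by rintro rfl; exact hz (hga _)
  have hl := h6.leaves_clearIn (x := z) hzu.ne
  have hcost : flowCost (clearIn g u) < gainCost G P a := by
    have e1 := flowCost_clearIn g u
    have e2 : flowCost g ≤ flowCost f :=
      Finset.sum_le_sum fun p _ => Finset.sum_le_sum fun q _ => hg p q
    omega
  refine ⟨z, hzu, hza, ?_, _, hcost, clearIn g u, h6.clearIn h8, le_rfl, ?_⟩
  · have := add_unitReach_le_flowMax (a := a) (h6.clearIn h8) (fun y => by
      have : clearIn g u a y ≤ g a y := clearIn_le _ _ _ _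
      rw [hga] at this; omega) hl hza
    omega
  · unfold Leaves at *; omega

end

/-! ### Strong vertices and demands -/

section

variable [Fintype V] [DecidableEq V] {G : SimpleGraph V} {P : V → ℕ}

local notation "𝐫" => unitReach G P
local notation "𝐑" => flowMax G P
local notation "𝐞" => sumExcess G P
local notation "𝐦" => coverCount G P
local notation "𝐒" => suppliers G P
local notation "𝐜" => gainCost G P

theorem sumExcess_add_coverCount (v : V) : 𝐞 v + 𝐦 v = ∑ a, 𝐫 a v := by
  rw [sumExcess, coverCount, Finset.card_filter, ← Finset.sum_add_distrib]
  refine Finset.sum_congr rfl fun a _ => ?_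
  split_ifs <;> omega

theorem coverCount_pos_of_le {a v : V} (h : 1 ≤ 𝐫 a v) : 1 ≤ 𝐦 v :=
  Finset.card_pos.2 ⟨a, by simp [h]⟩

theorem unitReach_eq_zero {v : V} (h : 𝐦 v = 0) (a : V) : 𝐫 a v = 0 := by
  by_contra h0
  have := coverCount_pos_of_le (G := G) (P := P) (a := a) (v := v) (by omega)
  omega

theorem exists_unit_of_coverCount_eq_one {v : V} (h : 𝐦 v = 1) :
    ∃ a, 1 ≤ 𝐫 a v ∧ ∀ b, b ≠ a → 𝐫 b v = 0 := by
  obtain ⟨a, ha⟩ := Finset.card_eq_one.1 h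
  have h1 : ∀ b, 1 ≤ 𝐫 b v ↔ b = a := fun b => by
    have := Finset.ext_iff.1 ha b
    simpa using this
  exact ⟨a, (h1 a).2 rfl, fun b hb => by have := mt (h1 b).1 hb; omega⟩

theorem unitReach_eq_zero_of_coverCount_eq_one {v a b : V} (h : 𝐦 v = 1) (ha : 1 ≤ 𝐫 a v)
    (hb : b ≠ a) : 𝐫 b v = 0 := by
  obtain ⟨a', h1, h2⟩ := exists_unit_of_coverCount_eq_one h
  by_cases e : a = a'
  · subst e; exact h2 b hb
  · have := h2 a e; omega

theorem sumExcess_eq_zero {v : V} (h : ∀ a, 𝐫 a v ≤ 1) : 𝐞 v = 0 :=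
  Finset.sum_eq_zero fun a _ => by have := h a; omega

theorem sumExcess_add_one {v a : V} (ha : 1 ≤ 𝐫 a v) (h : ∀ b, b ≠ a → 𝐫 b v ≤ 1) :
    𝐞 v + 1 = 𝐫 a v := by
  rw [sumExcess, Finset.sum_eq_single a (fun b _ hb => by have := h b hb; omega) (by simp)]
  omega

theorem exists_ne_of_two_le_coverCount {v : V} (h : 2 ≤ 𝐦 v) : ∃ a, v ≠ a ∧ 1 ≤ 𝐫 a v := by
  have h' : 1 < (Finset.univ.filter fun a => 1 ≤ 𝐫 a v).card := h
  obtain ⟨a, ha, hne⟩ := Finset.exists_mem_ne h' v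
  exact ⟨a, hne.symm, by simpa using ha⟩

/-- Some unit brings two pebbles to `v`, and hence covers all neighbours of `v`. -/
def IsStrong (G : SimpleGraph V) (P : V → ℕ) (v : V) : Prop := ∃ a, 2 ≤ unitReach G P a v

theorem sumExcess_eq_zero_of_not_isStrong {v : V} (h : ¬ IsStrong G P v) : 𝐞 v = 0 :=
  sumExcess_eq_zero fun a => by
    by_contra h0
    exact h ⟨a, by omega⟩

theorem one_le_of_adj {a x y : V} (hxy : G.Adj x y) (h : 2 ≤ 𝐫 a x) : 1 ≤ 𝐫 a y := by
  have := unitReach_le_of_adj P a hxy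
  omega

theorem IsStrong.one_le_coverCount {x y : V} (h : IsStrong G P x) (hxy : G.Adj x y) :
    1 ≤ 𝐦 y := by
  obtain ⟨a, ha⟩ := h
  exact coverCount_pos_of_le (one_le_of_adj hxy ha)

theorem gains_of_two_le {v : V} (h : ¬ IsStrong G P v) (hR : 2 ≤ 𝐑 v) : Gains G P v := by
  rw [Gains, sumExcess_eq_zero_of_not_isStrong h]; omega

theorem not_isStrong_of_coverCount_eq_zero {v : V} (h : 𝐦 v = 0) : ¬ IsStrong G P v := by
  rintro ⟨a, ha⟩
  have := unitReach_eq_zero h a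
  omega

theorem pebbles_eq_zero_of_coverCount_eq_zero {v : V} (h : 𝐦 v = 0) : P v = 0 := by
  rw [← unitReach_self G P v]; exact unitReach_eq_zero h v

/-- The vertex `v` gains or is reached by a unit. -/
def IsTouched (G : SimpleGraph V) (P : V → ℕ) (v : V) : Prop :=
  Gains G P v ∨ 1 ≤ coverCount G P v

theorem isTouched_of_two_le {v : V} (hR : 2 ≤ 𝐑 v) : IsTouched G P v := by
  by_cases h : 𝐦 v = 0
  · exact Or.inl (gains_of_two_le (not_isStrong_of_coverCount_eq_zero h) hR)
  · exact Or.inr (by omega)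

theorem two_le_flowMax_of_mem_suppliers {v x : V} (hx : x ∈ 𝐒 v) : 2 ≤ 𝐑 x := by
  have := add_two_le_flowMax_of_mem_suppliers hx
  omega

/-- Vertices that are not strong do not supply each other. -/
theorem not_mem_suppliers {u x : V} (hu : ¬ IsStrong G P u) (hx : ¬ IsStrong G P x)
    (h : x ∈ 𝐒 u) : u ∉ 𝐒 x := by
  intro h'
  -- Without strength `sumExcess` is 0, so the two pebbles held by a supplier already make it gain.
  -- Mutual supply would make each gain cost smaller than the other.
  obtain ⟨c, hc, h1⟩ := flowReach_of_mem_suppliers h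
  obtain ⟨d, hd, h2⟩ := flowReach_of_mem_suppliers h'
  have h3 := gainCost_le h1 (by rw [sumExcess_eq_zero_of_not_isStrong hx])
  have h4 := gainCost_le h2 (by rw [sumExcess_eq_zero_of_not_isStrong hu])
  omega

open Classical in
/-- What `u` demands from the edge to its supplier `x`, in addition to one half of the edge. -/
noncomputable def demand (G : SimpleGraph V) (P : V → ℕ) (u x : V) : ℕ :=
  if x ∈ suppliers G P u then
    if coverCount G P u = 0 then if suppliers G P u = {x} then 2 else 1
    else if coverCount G P u = 1 ∧ suppliers G P u = {x} ∧
      (¬ IsStrong G P u ∨ flowMax G P u = sumExcess G P u + 2) then 1 else 0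
  else 0

theorem demand_le_two (u x : V) : demand G P u x ≤ 2 := by
  unfold demand
  split_ifs <;> omega

theorem demand_eq_two {u x : V} (h : demand G P u x = 2) : 𝐦 u = 0 ∧ 𝐒 u = {x} := by
  unfold demand at h
  split_ifs at h with h1 h2 h3 h4 <;> first | omega | exact ⟨h2, h3⟩

theorem mem_suppliers_of_demand {u x : V} (h : demand G P u x ≠ 0) : x ∈ 𝐒 u := by
  by_contra h0
  simp [demand, h0] at h

theorem of_demand {u x : V} (h : demand G P u x ≠ 0) (hm : 𝐦 u ≠ 0) :
    𝐦 u = 1 ∧ 𝐒 u = {x} ∧ (¬ IsStrong G P u ∨ 𝐑 u = 𝐞 u + 2) := by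
  unfold demand at h
  split_ifs at h with h1 h3
  · exact h3
  · exact absurd rfl h
  · exact absurd rfl h

theorem isTouched_of_demand {u x : V} (h : demand G P u x ≠ 0) : IsTouched G P u :=
  Or.inl (gains_of_mem_suppliers (mem_suppliers_of_demand h))

theorem pebbles_eq_zero {x a : V} (hm : 𝐦 x = 1) (ha : 1 ≤ 𝐫 a x) (hxa : x ≠ a) : P x = 0 := by
  rw [← unitReach_self G P x]
  exact unitReach_eq_zero_of_coverCount_eq_one hm ha hxa

theorem sumExcess_add_one_of_coverCount {x a : V} (hm : 𝐦 x = 1) (ha : 1 ≤ 𝐫 a x) :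
    𝐞 x + 1 = 𝐫 a x :=
  sumExcess_add_one ha fun b hb => by
    rw [unitReach_eq_zero_of_coverCount_eq_one hm ha hb]; omega

/-- As `x` has no pebbles of its own, all `𝐞 x + 2 = 𝐫 a x + 1` of them pass through `u`, at twice
the price. -/
theorem flowReach_of_sole {x u a : V} (hm : 𝐦 x = 1) (ha : 1 ≤ 𝐫 a x) (hS : 𝐒 x = {u})
    (hxa : x ≠ a) : ∃ c < 𝐜 x, FlowReach G P c (2 * 𝐫 a x + 2) u := by
  obtain ⟨c, hc, h⟩ := flowReach_of_suppliers_eq hS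
  have h1 := sumExcess_add_one_of_coverCount hm ha
  rw [pebbles_eq_zero hm ha hxa] at h
  exact ⟨c, hc, h.mono le_rfl (by omega)⟩

theorem flowReach_four {x u : V} (hm : ¬ IsStrong G P x) (hP : P x = 0) (hS : 𝐒 x = {u}) :
    ∃ c < 𝐜 x, FlowReach G P c 4 u := by
  obtain ⟨c, hc, h⟩ := flowReach_of_suppliers_eq hS
  rw [sumExcess_eq_zero_of_not_isStrong hm, hP] at h
  exact ⟨c, hc, h⟩

/-- This confines payments to gaining vertices: all others neither pay nor collect. Only a strong
`x` needs care. Its unit is then the only one at `u`, and if `x` did not gain, also the only one at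
`x`; what `x` must hold to supply `u` then exceeds what this unit brings. -/
theorem gains_of_demand {u x : V} (h : demand G P u x ≠ 0) : Gains G P x := by
  have hx := mem_suppliers_of_demand h
  have hxu := adj_of_mem_suppliers hx
  have hR := two_le_flowMax_of_mem_suppliers hx
  by_cases hm : 𝐦 u = 0
  · exact gains_of_two_le (fun hs => by have := hs.one_le_coverCount hxu; omega) hR
  obtain ⟨hm1, hS, -⟩ := of_demand h hm
  obtain ⟨a, ha, hb⟩ := exists_unit_of_coverCount_eq_one hm1
  by_cases hs : IsStrong G P x
  swap
  · exact gains_of_two_le hs hR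
  obtain ⟨b, hbx⟩ := hs
  have hba : b = a := by
    by_contra hne
    have := one_le_of_adj hxu hbx
    have := hb b hne
    omega
  subst hba
  have hle := sum_unitReach_le_flowMax (G := G) (P := P) x
  rw [← sumExcess_add_coverCount] at hle
  by_contra hng
  unfold Gains at hng
  have hm1x : 𝐦 x = 1 := by
    have := coverCount_pos_of_le (G := G) (P := P) (a := b) (v := x) (by omega)
    omega
  have hex := sumExcess_add_one_of_coverCount hm1x (a := b) (by omega)
  by_cases hub : u = b
  · subst hub
    have := add_two_le_flowMax_of_mem_suppliers hx
    omega
  · obtain ⟨c, -, hc⟩ := flowReach_of_sole hm1 ha hS hub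
    have h1 := hc.le_flowMax
    have h2 := unitReach_le_of_adj P b hxu
    omega

/-- A strong vertex `x` that demands something from its neighbour `u`. -/
theorem of_strong_demand {a x u : V} (hxu : G.Adj x u) (hx : 2 ≤ 𝐫 a x)
    (h : demand G P x u ≠ 0) :
    𝐦 x = 1 ∧ 𝐒 x = {u} ∧ 𝐑 x = 𝐞 x + 2 ∧ 𝐞 x + 1 = 𝐫 a x ∧ 𝐞 u + 1 = 𝐫 a u ∧
      (∀ b, b ≠ a → 𝐫 b u ≤ 1) ∧
      ((x = a ∧ 𝐫 a u + 2 ≤ 𝐑 u) ∨ (x ≠ a ∧ 2 * 𝐫 a x + 2 ≤ 𝐑 u)) := by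
  have hm : 1 ≤ 𝐦 x := coverCount_pos_of_le (a := a) (by omega)
  obtain ⟨hm1, hS, hc⟩ := of_demand h (by omega)
  have hb : ∀ b, b ≠ a → 𝐫 b u ≤ 1 := fun b hb => by
    have h1 := unitReach_eq_zero_of_coverCount_eq_one hm1 (a := a) (by omega) hb
    have h2 := unitReach_le_of_adj P b hxu.symm
    omega
  refine ⟨hm1, hS, hc.resolve_left (fun hn => hn ⟨a, hx⟩),
    sumExcess_add_one_of_coverCount hm1 (by omega), sumExcess_add_one (one_le_of_adj hxu hx) hb,
    hb, ?_⟩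
  by_cases hxa : x = a
  · left
    refine ⟨hxa, ?_⟩
    have := add_two_le_flowMax_of_mem_suppliers (G := G) (P := P) (v := x) (x := u) (by simp [hS])
    rwa [hxa] at this
  · right
    refine ⟨hxa, ?_⟩
    obtain ⟨c, -, hc⟩ := flowReach_of_sole hm1 (by omega) hS hxa
    exact hc.le_flowMax

/-- The neighbour `x` of `u` on the way to `a` demands nothing unless `u` has a large excess. -/
theorem exists_predecessor {a u : V} (hua : u ≠ a) (h : 1 ≤ 𝐫 a u) :
    ∃ x, G.Adj x u ∧ 2 ≤ 𝐫 a x ∧ demand G P x u ≠ 2 ∧ (demand G P x u = 0 ∨ 𝐞 u + 6 ≤ 𝐑 u ∨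
      (x = a ∧ 𝐦 a = 1 ∧ 𝐒 a = {u} ∧ 𝐞 u + 3 ≤ 𝐑 u)) := by
  obtain ⟨x, hxu, hx⟩ := exists_adj_unitReach_eq_div_two h hua
  have hx2 : 2 ≤ 𝐫 a x := by omega
  refine ⟨x, hxu, hx2, fun h2 => ?_, ?_⟩
  · have := unitReach_eq_zero (demand_eq_two h2).1 a
    omega
  by_cases hd : demand G P x u = 0
  · exact Or.inl hd
  obtain ⟨h1, h2, h3, h4, h5, h6, h7⟩ := of_strong_demand hxu hx2 hd
  -- Here `𝐞 u + 1 = 𝐫 a u = 𝐫 a x / 2`. If `x ≠ a`, the bound `2 * 𝐫 a x + 2` is at least `4 * (𝐞 u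
  -- + 1) + 2`.
  rcases h7 with ⟨rfl, h7⟩ | ⟨-, h7⟩
  · exact Or.inr (Or.inr ⟨rfl, h1, h2, by omega⟩)
  · exact Or.inr (Or.inl (by omega))

/-- If the only supplier of `a` is `u`, then not all neighbours of `u` depend on `u`. -/
theorem not_all_supplied {a u : V} (hma : 𝐦 a = 1) (hPa : 1 ≤ P a) (hS : 𝐒 a = {u})
    (hPu : P u ≤ 1) (hP : P a + 1 ≤ 2 * (4 - P u))
    (hall : ∀ z, G.Adj z u → z ≠ a → IsTouched G P z →
      ¬ IsStrong G P z ∧ 𝐒 z = {u} ∧ P z = 0) : False := by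
  classical
  have hea : 𝐞 a + 1 = P a := by
    have := sumExcess_add_one_of_coverCount hma (a := a) (by rw [unitReach_self]; exact hPa)
    rwa [unitReach_self] at this
  have key : ∀ z c, G.Adj z u → z ≠ a → FlowReach G P c 2 z → Gains G P z ∧ 𝐜 z ≤ c := by
    intro z c hzu hza hz
    have hR := hz.le_flowMax
    have hs := (hall z hzu hza (isTouched_of_two_le hR)).1
    exact ⟨gains_of_two_le hs hR,
      gainCost_le hz (by rw [sumExcess_eq_zero_of_not_isStrong hs])⟩
  obtain ⟨z0, hz0, hz0a, -, c0, hc0, hr0⟩ := exists_supplier_of_suppliers_eq hS hPu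
  obtain ⟨hg0, hle0⟩ := key z0 c0 hz0 hz0a hr0
  -- Take the cheapest gaining neighbour `z` of `u` other than `a`. To serve it, `u` needs four
  -- pebbles, and by minimality only `a` can supply those that `u` lacks.
  obtain ⟨z, hz, hmin⟩ := Finset.exists_min_image
    (Finset.univ.filter fun z => G.Adj z u ∧ z ≠ a ∧ Gains G P z) 𝐜 ⟨z0, by simp [hz0, hz0a, hg0]⟩
  simp only [Finset.mem_filter, Finset.mem_univ, true_and] at hz hmin
  obtain ⟨hs, hSz, hPz⟩ := hall z hz.1 hz.2.1 (Or.inl hz.2.2)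
  obtain ⟨c, hc, hr⟩ := flowReach_four hs hPz hSz
  obtain ⟨j, hj, hw⟩ := hr.exists_suppliers (by omega)
  have hja : ∀ w, w ≠ a → j w = 0 := by
    intro w hwa
    by_contra h0
    obtain ⟨hwu, c', hc', hr'⟩ := hw w h0
    obtain ⟨hg, hle⟩ := key w c' hwu hwa (hr'.mono le_rfl (by omega))
    have := hmin w ⟨hwu, hwa, hg⟩
    omega
  rw [Finset.sum_eq_single a (fun w _ hw => hja w hw) (by simp)] at hj
  obtain ⟨-, c', hc', hr'⟩ := hw a (by omega)
  -- The pebbles that `a` would have to hold make `a` gain more cheaply than `z`, hence than `z0`,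
  -- which in turn costs less than `a`.
  have h1 := gainCost_le hr' (by omega)
  have h2 := hmin z0 ⟨hz0, hz0a, hg0⟩
  omega

end

/-! ### The local discharging inequality -/

section

variable [Fintype V] [DecidableEq V] {G : SimpleGraph V} {P : V → ℕ}

local notation "𝐫" => unitReach G P
local notation "𝐑" => flowMax G P
local notation "𝐞" => sumExcess G P
local notation "𝐦" => coverCount G P
local notation "𝐒" => suppliers G P
local notation "𝐜" => gainCost G P

variable [DecidableRel G.Adj]

open Classical in
/-- The neighbours of `u` that leave their half of the edge to `u`. -/
noncomputable def freeNeighbors (G : SimpleGraph V) [DecidableRel G.Adj] (P : V → ℕ) (u : V) :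
    Finset V :=
  (G.neighborFinset u).filter fun x => IsTouched G P x ∧ demand G P x u = 0

/-- The neighbours of `u` that demand more than the whole edge. -/
noncomputable def heavyNeighbors (G : SimpleGraph V) [DecidableRel G.Adj] (P : V → ℕ) (u : V) :
    Finset V :=
  (G.neighborFinset u).filter fun x => demand G P x u = 2

theorem mem_freeNeighbors {u x : V} : x ∈ freeNeighbors G P u ↔
    G.Adj x u ∧ IsTouched G P x ∧ demand G P x u = 0 := by
  simp [freeNeighbors, G.adj_comm]

theorem mem_heavyNeighbors {u x : V} : x ∈ heavyNeighbors G P u ↔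
    G.Adj x u ∧ demand G P x u = 2 := by
  simp [heavyNeighbors, G.adj_comm]

theorem suppliers_subset (u : V) : 𝐒 u ⊆ G.neighborFinset u := fun x hx => by
  simpa using (adj_of_mem_suppliers hx).symm

/-- No unit reaches a heavy neighbour, so `u` is not strong and must by itself provide both of its
pebbles, which takes four on `u`. -/
theorem of_mem_heavyNeighbors {u x : V} (h : x ∈ heavyNeighbors G P u) :
    ¬ IsStrong G P x ∧ P x = 0 ∧ 𝐒 x = {u} ∧ ¬ IsStrong G P u ∧ 4 ≤ 𝐑 u := by
  rw [mem_heavyNeighbors] at h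
  obtain ⟨hm, hS⟩ := demand_eq_two h.2
  have h1 := not_isStrong_of_coverCount_eq_zero hm
  have h2 := pebbles_eq_zero_of_coverCount_eq_zero hm
  refine ⟨h1, h2, hS, fun hs => ?_, ?_⟩
  · have := hs.one_le_coverCount h.1.symm
    omega
  · obtain ⟨c, -, hc⟩ := flowReach_four h1 h2 hS
    exact hc.le_flowMax

theorem card_heavyNeighbors_add_le {u : V} {s : Finset V} (hs : s ⊆ G.neighborFinset u)
    (h : ∀ x ∈ s, demand G P x u ≠ 2) :
    (heavyNeighbors G P u).card + s.card ≤ G.degree u := by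
  rw [← Finset.card_union_of_disjoint, ← G.card_neighborFinset_eq_degree]
  · exact Finset.card_le_card (Finset.union_subset (Finset.filter_subset _ _) hs)
  · rw [Finset.disjoint_left]
    intro x hx hxs
    exact h x hxs (mem_heavyNeighbors.1 hx).2

theorem mem_freeNeighbors_of_not_isStrong {u x : V} (hu : ¬ IsStrong G P u)
    (hx : ¬ IsStrong G P x) (h : x ∈ 𝐒 u) : x ∈ freeNeighbors G P u := by
  refine mem_freeNeighbors.2 ⟨adj_of_mem_suppliers h,
    isTouched_of_two_le (two_le_flowMax_of_mem_suppliers h), ?_⟩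
  by_contra h0
  exact not_mem_suppliers hu hx h (mem_suppliers_of_demand h0)

theorem Gains.card_suppliers_pos {u : V} (h : Gains G P u) (hP : P u < 𝐞 u + 2) :
    0 < (𝐒 u).card := by
  rw [Finset.card_pos, Finset.nonempty_iff_ne_empty]
  intro h0
  have := h.le_sum_suppliers
  rw [h0, Finset.sum_empty] at this
  omega

theorem one_le_sum_demand {u x : V} (hm : 𝐦 u = 1) (hS : 𝐒 u = {x})
    (h : ¬ IsStrong G P u ∨ 𝐑 u = 𝐞 u + 2) : 1 ≤ ∑ x, demand G P u x := by
  refine le_trans ?_ (Finset.single_le_sum (fun _ _ => Nat.zero_le _) (Finset.mem_univ x))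
  simp [demand, hm, hS, h]

theorem two_le_sum_demand {u : V} (hm : 𝐦 u = 0) (hS : 0 < (𝐒 u).card) :
    2 ≤ ∑ x, demand G P u x := by
  by_cases h1 : (𝐒 u).card = 1
  · obtain ⟨x, hx⟩ := Finset.card_eq_one.1 h1
    refine le_trans ?_ (Finset.single_le_sum (fun _ _ => Nat.zero_le _) (Finset.mem_univ x))
    simp [demand, hm, hx]
  · calc 2 ≤ ∑ x ∈ 𝐒 u, 1 := by simp; omega
      _ ≤ ∑ x ∈ 𝐒 u, demand G P u x := by
        refine Finset.sum_le_sum fun x hx => ?_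
        rw [demand, if_pos hx, if_pos hm]
        split_ifs <;> omega
      _ ≤ _ := Finset.sum_le_sum_of_subset (Finset.subset_univ _)

/-- A strong neighbour would cover `u`, so no supplier is strong and all are free. They and the
demand of `u` give 3; a heavy neighbour forces `g ≥ 2`, which pays for all heavy ones. -/
theorem discharge_uncovered {u : V} {d g : ℕ} (hdeg : G.degree u = d + 3)
    (hg : 𝐑 u = 𝐞 u + 2 + g) (hm : 𝐦 u = 0) :
    3 + (heavyNeighbors G P u).card ≤
      (freeNeighbors G P u).card + ∑ x, demand G P u x + (d + 1) * g + 𝐦 u := by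
  have hG : Gains G P u := by unfold Gains; omega
  have hu := not_isStrong_of_coverCount_eq_zero hm
  have hS := hG.card_suppliers_pos (by rw [pebbles_eq_zero_of_coverCount_eq_zero hm]; omega)
  have hfree : 𝐒 u ⊆ freeNeighbors G P u := fun x hx =>
    mem_freeNeighbors_of_not_isStrong hu (fun hs => by
      have := hs.one_le_coverCount (adj_of_mem_suppliers hx)
      omega) hx
  have h1 := Finset.card_le_card hfree
  have hheavy : ∀ x ∈ 𝐒 u, demand G P x u ≠ 2 := fun x hx h => by
    have := (mem_freeNeighbors.1 (hfree hx)).2.2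
    omega
  have h2 := card_heavyNeighbors_add_le (suppliers_subset u) hheavy
  have h3 := two_le_sum_demand hm hS
  rcases Finset.eq_empty_or_nonempty (heavyNeighbors G P u) with h0 | ⟨y, hy⟩
  · rw [h0, Finset.card_empty]; omega
  · have h4 := (of_mem_heavyNeighbors hy).2.2.2.2
    have h5 := sumExcess_eq_zero_of_not_isStrong hu
    have h6 : (d + 1) * 2 ≤ (d + 1) * g := Nat.mul_le_mul_left _ (by omega)
    omega

theorem discharge_covered_once {u : V} {d g : ℕ} (hdeg : G.degree u = d + 3)
    (hg : 𝐑 u = 𝐞 u + 2 + g) (hm : 𝐦 u = 1) (hu : ¬ IsStrong G P u) :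
    3 + (heavyNeighbors G P u).card ≤
      (freeNeighbors G P u).card + ∑ x, demand G P u x + (d + 1) * g + 𝐦 u := by
  have hG : Gains G P u := by unfold Gains; omega
  have he := sumExcess_eq_zero_of_not_isStrong hu
  obtain ⟨a, ha, -⟩ := exists_unit_of_coverCount_eq_one hm
  have hr : ∀ b, 𝐫 b u ≤ 1 := fun b => by
    by_contra h0
    exact hu ⟨b, by omega⟩
  have hPu := hr u
  rw [unitReach_self] at hPu
  have hS := hG.card_suppliers_pos (by omega)
  have hheavy : ∀ x ∈ 𝐒 u, demand G P x u ≠ 2 := by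
    intro x hx h2
    have h3 := mem_freeNeighbors_of_not_isStrong hu
      (of_mem_heavyNeighbors (mem_heavyNeighbors.2 ⟨adj_of_mem_suppliers hx, h2⟩)).1 hx
    have := (mem_freeNeighbors.1 h3).2.2
    omega
  have h2 := card_heavyNeighbors_add_le (suppliers_subset u) hheavy
  have hg2 : (heavyNeighbors G P u).card ≠ 0 → 2 ≤ g := fun h0 => by
    obtain ⟨y, hy⟩ := Finset.card_ne_zero.1 h0
    have := (of_mem_heavyNeighbors hy).2.2.2.2
    omega
  -- A supplier that itself demands from `u` is strong through the unit `a` that covers `u`. If it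
  -- is not `a`, then `𝐑 u ≥ 6`. If it is `a`, cost minimality yields another supplier; as `a` has
  -- at most three pebbles, that one is not strong, hence free.
  have key : ∀ x ∈ 𝐒 u, x ∈ freeNeighbors G P u ∨ 4 ≤ g ∨
      (1 ≤ g ∧ 0 < (freeNeighbors G P u).card) := by
    intro x hx
    have hxu := adj_of_mem_suppliers hx
    by_cases hxs : IsStrong G P x
    swap
    · exact Or.inl (mem_freeNeighbors_of_not_isStrong hu hxs hx)
    by_cases hd : demand G P x u = 0
    · exact Or.inl (mem_freeNeighbors.2
        ⟨hxu, isTouched_of_two_le (two_le_flowMax_of_mem_suppliers hx), hd⟩)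
    right
    obtain ⟨b, hb⟩ := hxs
    have hba : b = a := by
      by_contra hne
      have h3 := unitReach_eq_zero_of_coverCount_eq_one hm ha hne
      have h4 := one_le_of_adj hxu hb
      omega
    subst hba
    obtain ⟨k1, k2, k3, k4, k5, k6, k7⟩ := of_strong_demand hxu hb hd
    rcases k7 with ⟨rfl, k7⟩ | ⟨-, k7⟩
    swap
    · left; omega
    right
    have hPx := unitReach_le_of_adj P x hxu
    have := hr x
    rw [unitReach_self] at hPx k4
    have hne : u ≠ x := hxu.ne'
    have hux : u ∈ 𝐒 x := by simp [k2]
    have hsole : 𝐒 u ≠ {x} := by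
      intro hS
      obtain ⟨c, hc, hr1⟩ := flowReach_of_sole hm ha hS hne
      obtain ⟨c', hc', hr2⟩ := flowReach_of_mem_suppliers hux
      have l1 := gainCost_le hr1 (by omega)
      have l2 := gainCost_le hr2 (by omega)
      omega
    obtain ⟨w, hw, hwx⟩ : ∃ w ∈ 𝐒 u, w ≠ x := by
      by_contra hcon
      push Not at hcon
      exact hsole (Finset.eq_singleton_iff_unique_mem.2 ⟨hx, hcon⟩)
    have hws : ¬ IsStrong G P w := by
      rintro ⟨b, hb⟩
      have hwu := adj_of_mem_suppliers hw
      by_cases hbx : b = x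
      · subst hbx
        obtain ⟨y, hy, hyw⟩ := exists_adj_unitReach_eq_div_two (by omega : 1 ≤ 𝐫 b w) hwx
        have : 𝐫 b y ≤ P b := by
          unfold unitReach
          split_ifs
          · exact Nat.div_le_self _ _
          · exact Nat.zero_le _
        omega
      · have h3 := unitReach_eq_zero_of_coverCount_eq_one hm ha hbx
        have h4 := one_le_of_adj hwu hb
        omega
    exact ⟨by omega, Finset.card_pos.2 ⟨w, mem_freeNeighbors_of_not_isStrong hu hws hw⟩⟩
  have hD : (𝐒 u).card = 1 → 1 ≤ ∑ x, demand G P u x := fun h1 => by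
    obtain ⟨x, hx⟩ := Finset.card_eq_one.1 h1
    exact one_le_sum_demand hm hx (Or.inl hu)
  obtain ⟨x, hx⟩ := Finset.card_pos.1 hS
  have hfree : g ≤ 3 → 0 < (freeNeighbors G P u).card := fun h3 => by
    rcases key x hx with h | h | h
    · exact Finset.card_pos.2 ⟨x, h⟩
    · omega
    · exact h.2
  have hmul : ∀ n, n ≤ g → (d + 1) * n ≤ (d + 1) * g := fun n hn => Nat.mul_le_mul_left _ hn
  by_cases h4 : 4 ≤ g
  · have := hmul 4 h4; omega
  by_cases h3 : 2 ≤ g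
  · have := hmul 2 h3
    have := hfree (by omega)
    by_cases h1 : (𝐒 u).card = 1
    · have := hD h1; omega
    · omega
  have h0 : (heavyNeighbors G P u).card = 0 := by
    by_contra h0
    have := hg2 h0
    omega
  by_cases h3 : 1 ≤ g
  · have := hmul 1 h3
    have := hfree (by omega)
    omega
  · have hsub : 𝐒 u ⊆ freeNeighbors G P u := fun y hy => by
      rcases key y hy with h | h | h
      · exact h
      · omega
      · omega
    have := Finset.card_le_card hsub
    by_cases h1 : (𝐒 u).card = 1
    · have := hD h1; omega
    · omega

/-- Now `𝐦 u` contributes 2, and one more is needed. It comes from the neighbour on a shortest path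
to a covering unit: this neighbour is free or `g` is positive. -/
theorem discharge_covered_twice {u : V} {d g : ℕ} (hdeg : G.degree u = d + 3)
    (hg : 𝐑 u = 𝐞 u + 2 + g) (hm : 2 ≤ 𝐦 u) :
    3 + (heavyNeighbors G P u).card ≤
      (freeNeighbors G P u).card + ∑ x, demand G P u x + (d + 1) * g + 𝐦 u := by
  obtain ⟨a, hua, ha⟩ := exists_ne_of_two_le_coverCount hm
  obtain ⟨x, hxu, hx, hx2, hcases⟩ := exists_predecessor hua ha
  have hxt : IsTouched G P x := Or.inr (coverCount_pos_of_le (a := a) (by omega))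
  have hcard := card_heavyNeighbors_add_le (G := G) (P := P) (u := u) (s := {x})
    (by simpa using hxu.symm) (by simpa using hx2)
  rw [Finset.card_singleton] at hcard
  have hfree : demand G P x u = 0 → 0 < (freeNeighbors G P u).card := fun h =>
    Finset.card_pos.2 ⟨x, mem_freeNeighbors.2 ⟨hxu, hxt, h⟩⟩
  have hmul : ∀ n, n ≤ g → (d + 1) * n ≤ (d + 1) * g := fun n hn => Nat.mul_le_mul_left _ hn
  by_cases h3 : 3 ≤ g
  · have := hmul 3 h3; omega
  by_cases h0 : (heavyNeighbors G P u).card = 0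
  · by_cases h1 : 1 ≤ g
    · have := hmul 1 h1; omega
    · rcases hcases with h | h | h
      · have := hfree h; omega
      · omega
      · omega
  obtain ⟨y, hy⟩ := Finset.card_ne_zero.1 h0
  obtain ⟨-, -, -, hu, hR⟩ := of_mem_heavyNeighbors hy
  have he := sumExcess_eq_zero_of_not_isStrong hu
  have := hmul 2 (by omega)
  by_cases hz : (heavyNeighbors G P u).card ≤ d + 1
  · omega
  rcases hcases with h | h | ⟨rfl, hma, hSa, -⟩
  · have := hfree h; omega
  · omega
  -- What remains is that `x` is a unit vertex with `u` as its sole supplier and that all other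
  -- neighbours of `u` are heavy: a circular dependence.
  exfalso
  have hr : ∀ b, 𝐫 b u ≤ 1 := fun b => by
    by_contra h0
    exact hu ⟨b, by omega⟩
  have hPu := hr u
  have hxr := hr x
  have hPx := unitReach_le_of_adj P x hxu
  rw [unitReach_self] at hPu hPx hx
  have hN : insert x (heavyNeighbors G P u) = G.neighborFinset u := by
    refine Finset.eq_of_subset_of_card_le (Finset.insert_subset (by simpa using hxu.symm)
      (Finset.filter_subset _ _)) ?_
    rw [Finset.card_insert_of_notMem (fun h => hx2 (mem_heavyNeighbors.1 h).2),
      G.card_neighborFinset_eq_degree]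
    omega
  refine not_all_supplied hma (by omega) hSa hPu (by omega) fun z hz hzx _ => ?_
  have hzN : z ∈ insert x (heavyNeighbors G P u) := by rw [hN]; simpa using hz.symm
  obtain ⟨h1, h2, h3, -⟩ := of_mem_heavyNeighbors (Finset.mem_of_mem_insert_of_ne hzN hzx)
  exact ⟨h1, h3, h2⟩

/-- Strength excludes heavy neighbours, and `g ≥ 2` suffices at once. For `g = 0` all suppliers are
free and a sole one also pays the demand; for `g = 1` one free neighbour is enough. -/
theorem discharge_strong {u : V} {d g : ℕ} (hg : 𝐑 u = 𝐞 u + 2 + g) (hm : 𝐦 u = 1)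
    (hu : IsStrong G P u) :
    3 + (heavyNeighbors G P u).card ≤
      (freeNeighbors G P u).card + ∑ x, demand G P u x + (d + 1) * g + 𝐦 u := by
  have hG : Gains G P u := by unfold Gains; omega
  have h0 : (heavyNeighbors G P u).card = 0 := by
    by_contra h0
    obtain ⟨y, hy⟩ := Finset.card_ne_zero.1 h0
    exact (of_mem_heavyNeighbors hy).2.2.2.1 hu
  have hmul : ∀ n, n ≤ g → (d + 1) * n ≤ (d + 1) * g := fun n hn => Nat.mul_le_mul_left _ hn
  by_cases h2 : 2 ≤ g
  · have := hmul 2 h2; omega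
  obtain ⟨a, ha⟩ := hu
  have he := sumExcess_add_one_of_coverCount hm (a := a) (by omega)
  have hother : ∀ b, b ≠ a → 𝐫 b u = 0 := fun b hb =>
    unitReach_eq_zero_of_coverCount_eq_one hm (by omega) hb
  have hPu : P u ≤ 𝐞 u + 1 := by
    by_cases h : u = a
    · subst h; rw [he, unitReach_self]
    · rw [← unitReach_self G P u, hother u h]; omega
  have hS := hG.card_suppliers_pos (by omega)
  have hdem : ∀ x, G.Adj x u → demand G P x u ≠ 0 → 1 ≤ 𝐫 a x ∧ 𝐦 x = 1 ∧ 𝐒 x = {u} ∧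
      (¬ IsStrong G P x ∨ 𝐑 x = 𝐞 x + 2) ∧ 𝐞 x + 1 = 𝐫 a x := by
    intro x hx hd
    have h1 := one_le_of_adj hx.symm ha
    have h3 := coverCount_pos_of_le h1
    obtain ⟨k1, k2, k3⟩ := of_demand hd (by omega)
    exact ⟨h1, k1, k2, k3, sumExcess_add_one_of_coverCount k1 h1⟩
  have htouch : ∀ x, G.Adj x u → IsTouched G P x := fun x hx =>
    Or.inr (coverCount_pos_of_le (one_le_of_adj hx.symm ha))
  -- a supplier that is not strong demands nothing
  have hweak : ∀ x ∈ 𝐒 u, x ≠ a → 𝐞 u + 2 ≤ 4 → ¬ IsStrong G P x → demand G P x u = 0 := by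
    intro x hx hxa h4 hxs
    by_contra hd
    obtain ⟨k1, k2, k3, -, k5⟩ := hdem x (adj_of_mem_suppliers hx) hd
    obtain ⟨c, hc, hr⟩ := flowReach_of_sole k2 k1 k3 hxa
    obtain ⟨c', hc', hr'⟩ := flowReach_of_mem_suppliers hx
    have l1 := gainCost_le hr (by omega)
    have l2 := gainCost_le hr' (by rw [sumExcess_eq_zero_of_not_isStrong hxs])
    omega
  have hsmall : ∀ x, G.Adj x u → demand G P x u ≠ 0 → ¬ IsStrong G P x → 𝐫 a u ≤ 3 := by
    intro x hx hd hxs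
    obtain ⟨k1, k2, k3, -, k5⟩ := hdem x hx hd
    have := unitReach_le_of_adj P a hx.symm
    have := sumExcess_eq_zero_of_not_isStrong hxs
    omega
  -- A strong supplier `x` that demands satisfies `𝐑 x = 𝐞 x + 2`. This is too small if `u = a`;
  -- otherwise the bound from the reversed supply contradicts `g = 0`. A weak one is excluded by
  -- cost.
  have hcritical : u = a ∨ g = 0 → 𝐒 u ⊆ freeNeighbors G P u := by
    intro hcase x hx
    have hxu := adj_of_mem_suppliers hx
    refine mem_freeNeighbors.2 ⟨hxu, htouch x hxu, ?_⟩
    by_contra hd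
    obtain ⟨k1, k2, k3, k4, k5⟩ := hdem x hxu hd
    by_cases hxs : IsStrong G P x
    · have hRx := k4.resolve_left (fun h => h hxs)
      by_cases hua : u = a
      · subst hua
        have := add_two_le_flowMax_of_mem_suppliers hx
        omega
      · have hg0 := hcase.resolve_left hua
        by_cases hxa : x = a
        · subst hxa
          have := add_two_le_flowMax_of_mem_suppliers (G := G) (P := P) (v := x) (x := u)
            (by simp [k3])
          omega
        · obtain ⟨c, -, hr⟩ := flowReach_of_sole k2 k1 k3 hxa
          have h5 := hr.le_flowMax
          have h6 := sumExcess_add_four_le_of_mem_suppliers hx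
          omega
    · have h3 := hsmall x hxu hd hxs
      have h4 := sumExcess_eq_zero_of_not_isStrong hxs
      refine hd (hweak x hx ?_ (by omega) hxs)
      rintro rfl
      have h5 : u ≠ x := hxu.ne'
      obtain ⟨y, hy, hyx⟩ := exists_adj_unitReach_eq_div_two (by omega : 1 ≤ 𝐫 x u) h5
      have : 𝐫 x y ≤ P x := by
        unfold unitReach
        split_ifs
        · exact Nat.div_le_self _ _
        · exact Nat.zero_le _
      rw [unitReach_self] at k5
      omega
  by_cases hg0 : g = 0
  · have := Finset.card_le_card (hcritical (Or.inr hg0))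
    by_cases h1 : (𝐒 u).card = 1
    · obtain ⟨x, hx⟩ := Finset.card_eq_one.1 h1
      have := one_le_sum_demand hm hx (Or.inr (by omega))
      omega
    · omega
  have := hmul 1 (by omega)
  suffices 0 < (freeNeighbors G P u).card by omega
  by_cases hua : u = a
  · exact lt_of_lt_of_le hS (Finset.card_le_card (hcritical (Or.inl hua)))
  obtain ⟨x, hxu, hx, -, h | h | ⟨rfl, hma, hSa, -⟩⟩ := exists_predecessor hua (by omega : 1 ≤ 𝐫 a u)
  · exact Finset.card_pos.2 ⟨x, mem_freeNeighbors.2 ⟨hxu, htouch x hxu, h⟩⟩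
  · omega
  by_contra hcon
  have hPu0 : P u = 0 := by rw [← unitReach_self G P u, hother u hua]
  have hall : ∀ z, G.Adj z u → demand G P z u ≠ 0 := fun z hz h =>
    hcon (Finset.card_pos.2 ⟨z, mem_freeNeighbors.2 ⟨hz, htouch z hz, h⟩⟩)
  rw [unitReach_self] at hx
  obtain ⟨z, hzu, hzx, hRz, -⟩ := exists_supplier_of_suppliers_eq hSa (by omega)
  -- The vertex `z` has too many pebbles to be strong and demanding. Being weak, it bounds `𝐫 x u`
  -- by 3, hence `P x` by 7, exactly what `not_all_supplied` allows when `P u = 0`.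
  have hz3 : 𝐫 x u ≤ 3 := by
    obtain ⟨k1, k2, k3, k4, k5⟩ := hdem z hzu (hall z hzu)
    exact hsmall z hzu (hall z hzu) (k4.resolve_right (by omega))
  have hPx := unitReach_le_of_adj P x hxu
  rw [unitReach_self] at hPx
  refine not_all_supplied hma (by omega) hSa (by omega) (by omega) fun w hw hwx _ => ?_
  obtain ⟨k1, k2, k3, k4, k5⟩ := hdem w hw (hall w hw)
  refine ⟨?_, k3, pebbles_eq_zero k2 k1 hwx⟩
  rintro hs
  obtain ⟨b, hb⟩ := hs
  have hbx : b = x := by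
    by_contra hne
    have := unitReach_eq_zero_of_coverCount_eq_one k2 k1 hne
    omega
  subst hbx
  -- A strong `w` would force `𝐑 u ≥ 6`, whereas `𝐑 u = 𝐫 b u + 2 ≤ 5`.
  obtain ⟨c, -, hr⟩ := flowReach_of_sole k2 k1 k3 hwx
  have := hr.le_flowMax
  omega

/-- Every vertex that gains meets its own need. -/
theorem discharge {u : V} {d g : ℕ} (hdeg : G.degree u = d + 3) (hg : 𝐑 u = 𝐞 u + 2 + g) :
    3 + (heavyNeighbors G P u).card ≤
      (freeNeighbors G P u).card + ∑ x, demand G P u x + (d + 1) * g + 𝐦 u := by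
  rcases Nat.lt_trichotomy (𝐦 u) 1 with h | h | h
  · exact discharge_uncovered hdeg hg (by omega)
  · by_cases hs : IsStrong G P u
    · exact discharge_strong hg h hs
    · exact discharge_covered_once hdeg hg h hs
  · exact discharge_covered_twice hdeg hg h

end

/-! ### Summing the charges -/

section

variable [Fintype V] [DecidableEq V] {G : SimpleGraph V} {P : V → ℕ}

local notation "𝐫" => unitReach G P
local notation "𝐑" => flowMax G P
local notation "𝐞" => sumExcess G P
local notation "𝐦" => coverCount G P

variable [DecidableRel G.Adj]

/-- A vertex that a flow reaches, but that is not touched, has a neighbour that gains. -/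
theorem exists_gains_of_not_isTouched {v : V} (hR : 1 ≤ 𝐑 v) (h : ¬ IsTouched G P v) :
    ∃ u, G.Adj u v ∧ Gains G P u := by
  have hm : 𝐦 v = 0 := by
    by_contra h0
    exact h (Or.inr (by omega))
  obtain ⟨c, hc⟩ := le_flowMax_iff.1 hR
  have hP := pebbles_eq_zero_of_coverCount_eq_zero hm
  obtain ⟨j, hj, hw⟩ := hc.exists_suppliers (by omega)
  obtain ⟨u, -, hu⟩ := Finset.exists_ne_zero_of_sum_ne_zero (s := Finset.univ) (f := j) (by omega)
  obtain ⟨huv, c', -, hc'⟩ := hw u hu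
  refine ⟨u, huv, gains_of_two_le (fun hs => ?_) ?_⟩
  · have := hs.one_le_coverCount huv
    omega
  · have := hc'.le_flowMax
    omega

open Classical in
theorem discharge_sum {u : V} {d : ℕ} (hdeg : G.degree u = d + 3) (hG : Gains G P u) :
    (∑ x, (if G.Adj u x ∧ ¬ IsTouched G P x then 1 else 0) : ℤ) + ∑ x, (demand G P x u : ℤ) ≤
      ∑ x, (demand G P u x : ℤ) + ((d + 1) * (𝐑 u - 1 - 𝐞 u) + 𝐦 u - 1) := by
  obtain ⟨g, hg⟩ := Nat.exists_eq_add_of_le (show 𝐞 u + 2 ≤ 𝐑 u from hG)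
  have h1 := discharge hdeg hg
  -- Per neighbour, `u` pays 1 if it is untouched or demands 1, 2 if it is heavy, and 0 if it is
  -- free: the degree, plus the heavy ones, minus the free ones.
  have h2 : ∑ x, ((if G.Adj u x ∧ ¬ IsTouched G P x then 1 else 0) + (demand G P x u : ℤ) +
      (if x ∈ freeNeighbors G P u then 1 else 0)) ≤
      ∑ x, ((if x ∈ G.neighborFinset u then 1 else 0) +
        (if x ∈ heavyNeighbors G P u then 1 else 0)) := by
    refine Finset.sum_le_sum fun x _ => ?_
    have h3 := demand_le_two (G := G) (P := P) x u
    simp only [mem_freeNeighbors, mem_heavyNeighbors, SimpleGraph.mem_neighborFinset]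
    by_cases hd : demand G P x u = 0
    · by_cases hx : G.Adj u x
      · by_cases ht : IsTouched G P x <;> simp [hx, hx.symm, ht, hd]
      · have hx' : ¬ G.Adj x u := fun h => hx h.symm
        simp [hx, hx', hd]
    · have ht := isTouched_of_demand hd
      have hx := (adj_of_mem_suppliers (mem_suppliers_of_demand hd))
      by_cases hd2 : demand G P x u = 2
      · simp [hx, hx.symm, ht, hd2]
      · have hd1 : demand G P x u = 1 := by omega
        simp [hx, hx.symm, ht, hd1]
  simp only [Finset.sum_add_distrib, Finset.sum_ite_mem, Finset.univ_inter, Finset.sum_const,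
    G.card_neighborFinset_eq_degree, hdeg, nsmul_eq_mul, mul_one] at h2
  zify at h1
  push_cast at h2
  rw [hg]
  push_cast
  linarith

/-- The main inequality between the excess under flows and the number of uncovered vertices. -/
theorem sum_excess_flow {d : ℕ} (hdeg : ∀ u, G.degree u = d + 3) (hR : ∀ v, 1 ≤ 𝐑 v) :
    0 ≤ ∑ v, (((d : ℤ) + 1) * (𝐑 v - 1 - 𝐞 v) + 𝐦 v - 1) := by
  classical
  have key : ∀ v, (∑ x, (if Gains G P v ∧ G.Adj v x ∧ ¬ IsTouched G P x then 1 else 0) : ℤ)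
      + ∑ x, (demand G P x v : ℤ) ≤ ∑ x, (demand G P v x : ℤ) +
        (((d : ℤ) + 1) * (𝐑 v - 1 - 𝐞 v) + 𝐦 v - 1) +
        (if IsTouched G P v then 0 else 1) := by
    intro v
    by_cases hv : Gains G P v
    · have := discharge_sum (hdeg v) hv
      have ht : IsTouched G P v := Or.inl hv
      simpa [hv, ht] using this
    · have h1 : ∀ x, demand G P x v = 0 := fun x => by
        by_contra h
        exact hv (gains_of_demand h)
      have h2 : ∀ x, demand G P v x = 0 := fun x => by
        by_contra h
        exact hv (gains_of_mem_suppliers (mem_suppliers_of_demand h))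
      have h3 := sum_unitReach_le_flowMax (G := G) (P := P) v
      rw [← sumExcess_add_coverCount] at h3
      have h4 : 𝐞 v + 1 ≤ 𝐑 v := by
        by_cases hm : 𝐦 v = 0
        · have := sumExcess_eq_zero_of_not_isStrong (not_isStrong_of_coverCount_eq_zero hm)
          have := hR v
          omega
        · omega
      obtain ⟨k, hk⟩ := Nat.exists_eq_add_of_le h4
      have h5 : (0 : ℤ) ≤ ((d : ℤ) + 1) * k := by positivity
      have h6 : (0 : ℤ) ≤ 𝐦 v - 1 + if IsTouched G P v then 0 else 1 := by
        by_cases ht : IsTouched G P v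
        · have := ht.resolve_left hv
          simp only [ht, if_true]; omega
        · simp [ht]
      simp only [hv, h1, h2, false_and, if_false, Finset.sum_const_zero, Nat.cast_zero]
      rw [hk]
      push_cast
      linarith
  have hsum := Finset.sum_le_sum fun v (_ : v ∈ Finset.univ) => key v
  simp only [Finset.sum_add_distrib] at hsum ⊢
  have hcomm : ∑ v, ∑ x, (demand G P x v : ℤ) = ∑ v, ∑ x, (demand G P v x : ℤ) :=
    Finset.sum_comm
  -- Each untouched vertex receives its missing 1 from at least one gaining neighbour.
  have hnb : (∑ v, if IsTouched G P v then 0 else 1 : ℤ) ≤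
      ∑ v, ∑ x, (if Gains G P v ∧ G.Adj v x ∧ ¬ IsTouched G P x then 1 else 0) := by
    rw [Finset.sum_comm]
    refine Finset.sum_le_sum fun x _ => ?_
    by_cases ht : IsTouched G P x
    · simp [ht]
    · obtain ⟨u, hux, hu⟩ := exists_gains_of_not_isTouched (hR x) ht
      refine le_trans ?_ (Finset.single_le_sum (fun v _ => ?_) (Finset.mem_univ u))
      · simp [ht, hu, hux]
      · split_ifs <;> norm_num
  linarith

end

/-! ### Weights and the effect -/

open Classical in
/-- The weight `2 ^ (- dist a v)` of a pebble on `a` for the vertex `v`. -/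
noncomputable def weight (G : SimpleGraph V) (a v : V) : ℝ :=
  if G.Reachable a v then (1 / 2 : ℝ) ^ G.dist a v else 0

theorem weight_nonneg (G : SimpleGraph V) (a v : V) : 0 ≤ weight G a v := by
  unfold weight
  split_ifs <;> positivity

theorem weight_self (G : SimpleGraph V) (a : V) : weight G a a = 1 := by
  simp [weight]

/-- Distances to `v` differ by at most one along an edge, so trading two pebbles for one on a
neighbour never raises the weight. -/
theorem weight_le_two_mul_weight {G : SimpleGraph V} {x y v : V} (h : G.Adj x y) :
    weight G y v ≤ 2 * weight G x v := by
  unfold weight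
  by_cases hy : G.Reachable y v
  · have hx : G.Reachable x v := h.reachable.trans hy
    have hd : G.dist x v ≤ G.dist y v + 1 := by
      have := h.diff_dist_adj (u := v)
      rw [G.dist_comm (u := x), G.dist_comm (u := y)]
      omega
    simp only [hx, hy, if_true]
    have := pow_le_pow_of_le_one (by norm_num : (0 : ℝ) ≤ 1 / 2) (by norm_num) hd
    rw [pow_succ] at this
    linarith
  · simp only [hy, if_false]
    split_ifs <;> positivity

theorem mem_sphere {G : SimpleGraph V} {k : ℕ} {a v : V} :
    v ∈ sphere G k a ↔ G.Reachable a v ∧ G.dist a v = k := by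
  constructor
  · intro h
    have h' : G.edist a v = k := h
    exact ⟨SimpleGraph.reachable_of_edist_ne_top (by simp [h']), by simp [SimpleGraph.dist, h']⟩
  · rintro ⟨h1, h2⟩
    show G.edist a v = k
    rw [← h2, SimpleGraph.dist, ENat.natCast_toNat]
    exact SimpleGraph.edist_ne_top_iff_reachable.2 h1

section

variable [Fintype V] [DecidableEq V] {G : SimpleGraph V} {P : V → ℕ}

open Classical in
theorem sum_sphere {M : Type*} [Semiring M] (φ : ℕ → M) (n : ℕ) (a : V)
    (h : ∀ v, G.Reachable a v → n ≤ G.dist a v → φ (G.dist a v) = 0) :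
    ∑ k ∈ Finset.range n, ((sphere G k a).ncard : M) * φ k =
      ∑ v, if G.Reachable a v then φ (G.dist a v) else 0 := by
  have h1 : ∀ k, ((sphere G k a).ncard : M) * φ k =
      ∑ v, if G.Reachable a v ∧ G.dist a v = k then φ k else 0 := by
    intro k
    have : sphere G k a =
        ((Finset.univ.filter fun v => G.Reachable a v ∧ G.dist a v = k : Finset V) : Set V) := by
      ext v
      simp [mem_sphere]
    rw [this, Set.ncard_coe_finset, ← Finset.sum_filter, Finset.sum_const, nsmul_eq_mul]
  simp only [h1]
  rw [Finset.sum_comm]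
  refine Finset.sum_congr rfl fun v _ => ?_
  by_cases hr : G.Reachable a v
  · simp only [hr, true_and, if_true, Finset.sum_ite_eq, Finset.mem_range]
    split_ifs with hn
    · rfl
    · exact (h v hr (by omega)).symm
  · simp [hr]

theorem effect_eq_sum_weight (G : SimpleGraph V) (a : V) : effect G a = ∑ v, weight G a v := by
  classical
  set n := Finset.univ.sup (fun v => G.dist a v) + 1 with hn
  have hlt : ∀ v, G.dist a v < n := fun v =>
    Nat.lt_succ_of_le (Finset.le_sup (f := fun v => G.dist a v) (Finset.mem_univ v))
  have h0 : ∀ i, sphere G i a = ∅ → (1 / 2 : ℝ) ^ i * ((sphere G i a).ncard : ℝ) = 0 := by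
    intro i hi
    simp [hi]
  -- Beyond the diameter spheres are empty, so the range condition can be dropped, whether or not
  -- the graph is connected.
  have h1 : ∀ i : ℕ, (∑ᶠ (_ : (i : ℕ∞) ≤ G.ediam),
      (1 / 2 : ℝ) ^ i * ((sphere G i a).ncard : ℝ)) =
      (1 / 2 : ℝ) ^ i * ((sphere G i a).ncard : ℝ) := by
    intro i
    rw [finsum_eq_if]
    split_ifs with hi
    · rfl
    · refine (h0 i (Set.eq_empty_iff_forall_notMem.2 fun v hv => hi ?_)).symm
      have hv' : G.edist a v = i := hv
      rw [← hv']
      exact SimpleGraph.edist_le_ediam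
  unfold effect
  simp only [h1]
  rw [finsum_eq_sum_of_support_subset (s := Finset.range n)]
  · have := sum_sphere (G := G) (fun k => (1 / 2 : ℝ) ^ k) n a
      (fun v _ hv => absurd (hlt v) (by omega))
    simp only [mul_comm] at this ⊢
    rw [this]
    refine Finset.sum_congr rfl fun v _ => ?_
    by_cases hr : G.Reachable a v <;> simp [weight, hr]
  · intro i hi
    by_contra hin
    refine hi (h0 i (Set.eq_empty_iff_forall_notMem.2 fun v hv => hin ?_))
    have := (mem_sphere.1 hv).2
    have := hlt v
    simp only [Finset.coe_range, Set.mem_Iio]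
    omega

/-- A flow leaves no more pebbles on `v` than the weight of `P` for `v`. -/
theorem FlowReach.le_weight {c k : ℕ} {v : V} (h : FlowReach G P c k v) :
    (k : ℝ) ≤ ∑ a, P a * weight G a v := by
  obtain ⟨f, hf, -, hl⟩ := h
  have h1 : ∑ a, weight G a v * (2 * ∑ y, (f a y : ℝ) + if a = v then (k : ℝ) else 0) ≤
      ∑ a, weight G a v * (P a + ∑ x, (f x a : ℝ)) := by
    refine Finset.sum_le_sum fun a _ => mul_le_mul_of_nonneg_left ?_ (weight_nonneg _ _ _)
    by_cases ha : a = v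
    · subst ha
      simp only [if_true]
      unfold Leaves at hl
      exact_mod_cast hl
    · simp only [ha, if_false, add_zero]
      exact_mod_cast hf.balanced a
  have h2 : ∑ a, weight G a v * ∑ x, (f x a : ℝ) ≤
      ∑ a, weight G a v * (2 * ∑ y, (f a y : ℝ)) := by
    have e1 : ∑ a, weight G a v * ∑ x, (f x a : ℝ) = ∑ x, ∑ a, weight G a v * f x a := by
      rw [Finset.sum_comm]
      simp only [Finset.mul_sum]
    rw [e1]
    refine Finset.sum_le_sum fun x _ => ?_
    rw [Finset.mul_sum, Finset.mul_sum]
    refine Finset.sum_le_sum fun y _ => ?_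
    by_cases hxy : f x y = 0
    · simp [hxy]
    · have h3 := weight_le_two_mul_weight (v := v) (hf.adj x y hxy)
      have h4 : (0 : ℝ) ≤ f x y := Nat.cast_nonneg _
      nlinarith
  simp only [mul_add, Finset.sum_add_distrib, mul_ite, mul_zero, Finset.sum_ite_eq',
    Finset.mem_univ, if_true, weight_self, one_mul] at h1
  have e2 : ∑ a, (P a : ℝ) * weight G a v = ∑ a, weight G a v * P a :=
    Finset.sum_congr rfl fun a _ => mul_comm _ _
  rw [e2]
  linarith

theorem flowMax_le_weight (v : V) : (flowMax G P v : ℝ) ≤ ∑ a, P a * weight G a v := by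
  obtain ⟨c, hc⟩ := le_flowMax_iff.1 (le_refl (flowMax G P v))
  exact hc.le_weight

theorem sum_flowMax_le {e : ℝ} (he : ∀ a, effect G a = e) :
    ∑ v, (flowMax G P v : ℝ) ≤ size P * e := by
  refine (Finset.sum_le_sum fun v _ => flowMax_le_weight v).trans (le_of_eq ?_)
  rw [Finset.sum_comm, size, Nat.cast_sum, Finset.sum_mul]
  refine Finset.sum_congr rfl fun a _ => ?_
  rw [← he a, effect_eq_sum_weight, Finset.mul_sum]

/-! ### Reachability, units and their explicit formulas -/

theorem Moves.exists_flow {P' : V → ℕ} (h : Moves G P P') :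
    ∃ f : V → V → ℕ, (∀ x y, f x y ≠ 0 → G.Adj x y) ∧
      ∀ v, P v + ∑ x, f x v = P' v + 2 * ∑ y, f v y := by
  induction h with
  | refl => exact ⟨0, by simp, by simp⟩
  | tail _ hm ih =>
    obtain ⟨f, h1, h2⟩ := ih
    obtain ⟨u, w, huw, h3, h4, h5⟩ := hm
    have hne := huw.ne
    refine ⟨f + edgeFlow 1 u w, fun x y hxy => ?_, fun v => ?_⟩
    · by_cases h0 : x = u ∧ y = w
      · rw [h0.1, h0.2]; exact huw
      · exact h1 x y (by simpa [edgeFlow, h0] using hxy)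
    · have := h2 v
      simp only [Pi.add_apply, Finset.sum_add_distrib, sum_edgeFlow_left, sum_edgeFlow_right]
      by_cases hu : v = u
      · subst hu
        simp only [if_true, hne, if_false]
        omega
      · by_cases hw : v = w
        · subst hw
          simp only [if_true, hne.symm, if_false]
          omega
        · have := h5 v hu hw
          simp only [hu, hw, if_false]
          omega

theorem KReachable.flowReach {k : ℕ} {v : V} (h : KReachable G P k v) :
    ∃ c, FlowReach G P c k v := by
  obtain ⟨P', hm, hk⟩ := h
  obtain ⟨f, h1, h2⟩ := hm.exists_flow
  refine ⟨flowCost f, f, ⟨h1, fun v => ?_⟩, le_rfl, ?_⟩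
  · have := h2 v; omega
  · have := h2 v; unfold Leaves; omega

theorem KReachable.half {k : ℕ} {x v : V} (h : KReachable G P k x) (hxv : G.Adj x v) :
    KReachable G P (k / 2) v := by
  obtain ⟨P', hm, hk⟩ := h
  have hne := hxv.ne
  have key : ∀ j, 2 * j ≤ P' x → ∃ Q, Moves G P Q ∧ Q x + 2 * j = P' x ∧ j ≤ Q v := by
    intro j
    induction j with
    | zero => exact fun _ => ⟨P', hm, by simp, Nat.zero_le _⟩
    | succ j ih =>
      intro hj
      obtain ⟨Q, h1, h2, h3⟩ := ih (by omega)
      refine ⟨fun y => if y = x then Q x - 2 else if y = v then Q v + 1 else Q y,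
        h1.tail ⟨x, v, hxv, ?_, ?_, ?_⟩, ?_, ?_⟩
      · simp; omega
      · simp [hne.symm]
      · intro y hy hy'
        simp [hy, hy']
      · simp; omega
      · simp [hne.symm]; omega
  obtain ⟨Q, h1, -, h3⟩ := key (k / 2) (by omega)
  exact ⟨Q, h1, h3⟩

/-- The greatest number of pebbles that a unit can bring to `v`. -/
theorem kReachable_single_iff {a v : V} {k : ℕ} :
    KReachable G (Pi.single a (P a)) k v ↔ k ≤ unitReach G P a v := by
  constructor
  · intro h
    obtain ⟨c, hc⟩ := h.flowReach
    have h1 := hc.le_weight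
    rw [Finset.sum_eq_single a (fun b _ hb => by simp [hb]) (by simp), Pi.single_eq_same] at h1
    unfold weight at h1
    unfold unitReach
    split_ifs at h1 ⊢ with hr
    · rw [Nat.le_div_iff_mul_le (by positivity)]
      rw [one_div, inv_pow, ← div_eq_mul_inv, le_div_iff₀ (by positivity)] at h1
      exact_mod_cast h1
    · simpa using h1
  · suffices KReachable G (Pi.single a (P a)) (unitReach G P a v) v by
      intro h
      obtain ⟨Q, h1, h2⟩ := this
      exact ⟨Q, h1, h.trans h2⟩
    by_cases hr : G.Reachable a v
    · simp only [unitReach, hr, if_true]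
      induction hn : G.dist a v generalizing v with
      | zero =>
        rw [hr.dist_eq_zero_iff] at hn
        subst hn
        exact ⟨_, Relation.ReflTransGen.refl, by simp⟩
      | succ n ih =>
        have hne : v ≠ a := by rintro rfl; simp at hn
        obtain ⟨x, hx, hax, hd⟩ := exists_adj_dist_add_one hr hne
        have := (ih hax (by omega)).half hx
        rwa [Nat.div_div_eq_div_mul, ← pow_succ] at this
    · simp only [unitReach, hr, if_false]
      exact ⟨_, Relation.ReflTransGen.refl, Nat.zero_le _⟩

theorem reach_single (a v : V) : reach G (Pi.single a (P a)) v = unitReach G P a v := by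
  have h := isGreatest_reach G (Pi.single a (P a)) v
  exact le_antisymm (kReachable_single_iff.1 h.1) (h.2 (kReachable_single_iff.2 le_rfl))

theorem totalExcess_single (a : V) :
    totalExcess G (Pi.single a (P a)) = ∑ v, (unitReach G P a v - 1) := by
  simp only [totalExcess, excess, reach_single]

theorem cov_single (a : V) :
    cov G (Pi.single a (P a)) = ∑ v, if 1 ≤ unitReach G P a v then 1 else 0 := by
  have : {v | Reachable G (Pi.single a (P a)) v} =
      ((Finset.univ.filter fun v => 1 ≤ unitReach G P a v : Finset V) : Set V) := by
    ext v
    simp [Reachable, kReachable_single_iff]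
  rw [cov, this, Set.ncard_coe_finset, Finset.card_filter]

theorem unitReach_eq_zero_of_pebbles {a : V} (h : P a = 0) (v : V) : unitReach G P a v = 0 := by
  simp [unitReach, h]

theorem unitExcess_eq_sum : unitExcess G P = ∑ v, sumExcess G P v := by
  classical
  unfold unitExcess sumExcess
  rw [Finset.sum_comm, Finset.sum_filter]
  refine Finset.sum_congr rfl fun a _ => ?_
  split_ifs with h
  · rw [← totalExcess_single]
    congr!
  · simp [unitReach_eq_zero_of_pebbles (Nat.eq_zero_of_not_pos h)]

theorem cov_single_eq_sum (a : V) (hP : 0 < P a) : cov G (Pi.single a (P a)) =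
    ∑ k ∈ Finset.range (Nat.log 2 (P a) + 1), (sphere G k a).ncard := by
  classical
  have h := sum_sphere (G := G) (M := ℕ) (fun k => if 1 ≤ P a / 2 ^ k then 1 else 0)
    (Nat.log 2 (P a) + 1) a (fun v _ hv => by
      rw [Nat.div_eq_of_lt (Nat.lt_pow_of_log_lt (by norm_num) hv)]; simp)
  simp only [Nat.cast_id] at h
  rw [cov_single]
  trans ∑ k ∈ Finset.range (Nat.log 2 (P a) + 1),
    (sphere G k a).ncard * (if 1 ≤ P a / 2 ^ k then 1 else 0)
  · rw [h]
    refine Finset.sum_congr rfl fun v _ => ?_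
    by_cases hr : G.Reachable a v <;> simp [unitReach, hr]
  · refine Finset.sum_congr rfl fun k hk => ?_
    have : 2 ^ k ≤ P a := Nat.pow_le_of_le_log hP.ne' (by simpa [Nat.lt_succ_iff] using hk)
    rw [if_pos ((Nat.one_le_div_iff (by positivity)).2 this), mul_one]

theorem totalExcess_single_eq_sum (a : V) : totalExcess G (Pi.single a (P a)) =
    ∑ k ∈ Finset.range (Nat.log 2 (P a) + 1), (sphere G k a).ncard * (P a / 2 ^ k - 1) := by
  classical
  have h := sum_sphere (G := G) (M := ℕ) (fun k => P a / 2 ^ k - 1)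
    (Nat.log 2 (P a) + 1) a (fun v _ hv => by
      rw [Nat.div_eq_of_lt (Nat.lt_pow_of_log_lt (by norm_num) hv), Nat.zero_sub])
  simp only [Nat.cast_id] at h
  rw [totalExcess_single, h]
  refine Finset.sum_congr rfl fun v _ => ?_
  by_cases hr : G.Reachable a v <;> simp [unitReach, hr]

theorem IsUnitDecomposition.eq_single {t : ℕ} {U : Fin t → V → ℕ} (hU : IsUnitDecomposition P U)
    {i : Fin t} {u : V} (hu : 0 < U i u) : U i = Pi.single u (P u) := by
  have hPu : P u = U i u := by
    rw [← hU.sum_eq, Finset.sum_apply]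
    refine Finset.sum_eq_single i (fun j _ hj => ?_) (by simp)
    have := hU.disjoint j i hj u
    omega
  funext v
  by_cases hv : v = u
  · subst hv; simp [hPu]
  · obtain ⟨w, -, hw⟩ := hU.isUnit i
    have h1 := hw u hu
    have h2 : ¬ 0 < U i v := fun h => hv ((hw v h).trans h1.symm)
    simp [hv]; omega

/-- Count the pairs of a unit and a vertex that it reaches; each vertex with pebbles carries exactly
one unit. -/
theorem sum_cov_eq {t : ℕ} {U : Fin t → V → ℕ} (hU : IsUnitDecomposition P U) :
    ∑ i, cov G (U i) = ∑ v, coverCount G P v := by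
  have h1 : ∀ i, cov G (U i) =
      ∑ a, if 0 < U i a then ∑ v, (if 1 ≤ unitReach G P a v then 1 else 0) else 0 := by
    intro i
    obtain ⟨u, hu, huniq⟩ := hU.isUnit i
    rw [Finset.sum_eq_single u (fun a _ ha => if_neg fun h => ha (huniq a h)) (by simp), if_pos hu,
      ← cov_single, ← hU.eq_single hu]
  simp only [h1, coverCount, Finset.card_filter]
  refine Finset.sum_comm.trans (Eq.trans ?_ Finset.sum_comm)
  refine Finset.sum_congr rfl fun a _ => ?_
  by_cases hP : P a = 0
  · simp [unitReach_eq_zero_of_pebbles hP]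
  · have : ∑ i, U i a ≠ 0 := by
      rw [← Finset.sum_apply, hU.sum_eq]; exact hP
    obtain ⟨i, -, hi⟩ := Finset.exists_ne_zero_of_sum_ne_zero this
    rw [Finset.sum_eq_single i (fun j _ hj => if_neg ?_) (by simp), if_pos (by omega)]
    have := hU.disjoint j i hj a
    omega

end

/-! ### Vertex-transitivity and the final bound -/

theorem dist_map_iso {G : SimpleGraph V} (f : G ≃g G) (a v : V) :
    G.dist (f a) (f v) = G.dist a v := by
  have key : ∀ (g : G ≃g G) (x y : V), G.Reachable x y → G.dist (g x) (g y) ≤ G.dist x y := by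
    intro g x y h
    obtain ⟨p, hp⟩ := h.exists_walk_length_eq_dist
    have := SimpleGraph.dist_le (p.map g.toHom)
    rw [SimpleGraph.Walk.length_map, hp] at this
    exact this
  by_cases h : G.Reachable a v
  · refine le_antisymm (key f a v h) ?_
    have := key f.symm (f a) (f v) (SimpleGraph.Iso.reachable_iff.2 h)
    simpa using this
  · rw [SimpleGraph.dist_eq_zero_of_not_reachable h,
      SimpleGraph.dist_eq_zero_of_not_reachable (mt SimpleGraph.Iso.reachable_iff.1 h)]

theorem VertexTransitive.effect_eq [Fintype V] {G : SimpleGraph V} (hG : VertexTransitive G)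
    (a b : V) : effect G a = effect G b := by
  classical
  obtain ⟨f, rfl⟩ := hG b a
  rw [effect_eq_sum_weight, effect_eq_sum_weight, ← Equiv.sum_comp f.toEquiv]
  refine Finset.sum_congr rfl fun v _ => ?_
  have h1 : G.Reachable (f b) (f v) ↔ G.Reachable b v := SimpleGraph.Iso.reachable_iff
  have h2 := dist_map_iso f b v
  show weight G (f b) (f v) = _
  by_cases hr : G.Reachable b v <;> simp [weight, h1, h2, hr]

theorem VertexTransitive.degree_eq [Fintype V] {G : SimpleGraph V} [DecidableRel G.Adj]
    (hG : VertexTransitive G) (a : V) : G.degree a = G.maxDegree := by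
  have : Nonempty V := ⟨a⟩
  obtain ⟨b, hb⟩ := G.exists_maximal_degree_vertex
  obtain ⟨f, rfl⟩ := hG a b
  rw [hb, f.degree_eq]

section

variable [Fintype V] [DecidableEq V] {G : SimpleGraph V} {P : V → ℕ}

theorem card_le_sum_coverCount (h : ∀ v w, ¬ G.Adj v w) (hR : ∀ v, 1 ≤ flowMax G P v) :
    Fintype.card V ≤ ∑ v, coverCount G P v := by
  rw [← Finset.card_univ, Finset.card_eq_sum_ones]
  refine Finset.sum_le_sum fun v _ => coverCount_pos_of_le (a := v) ?_
  rw [unitReach_self]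
  by_contra hP
  obtain ⟨c, hc⟩ := le_flowMax_iff.1 (hR v)
  obtain ⟨j, hj, hw⟩ := hc.exists_suppliers (by omega)
  obtain ⟨u, -, hu⟩ := Finset.exists_ne_zero_of_sum_ne_zero (s := Finset.univ) (f := j) (by omega)
  exact h _ _ (hw u hu).1

/-- The numerator of the bound is at most the sum of the numbers of pebbles that flows leave. -/
theorem numerator_le_sum_flowMax [DecidableRel G.Adj] {D : ℕ} (hdeg : ∀ u, G.degree u = D)
    (hD : D ≠ 2) (hR : ∀ v, 1 ≤ flowMax G P v) :
    ((D : ℝ) - 1) / ((D : ℝ) - 2) * Fintype.card V + ∑ v, (sumExcess G P v : ℝ)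
      - 1 / ((D : ℝ) - 2) * ∑ v, (coverCount G P v : ℝ) ≤ ∑ v, (flowMax G P v : ℝ) := by
  have hsup : ∑ v, (sumExcess G P v : ℝ) + ∑ v, (coverCount G P v : ℝ) ≤
      ∑ v, (flowMax G P v : ℝ) := by
    rw [← Finset.sum_add_distrib]
    refine Finset.sum_le_sum fun v _ => ?_
    have := sum_unitReach_le_flowMax (G := G) (P := P) v
    rw [← sumExcess_add_coverCount] at this
    exact_mod_cast this
  -- For `D ≤ 1` the factor `1 / (D - 2)` is negative and `hsup` replaces discharging. For `D = 1`
  -- the term in `|V|` vanishes; for `D = 0` every vertex must own a pebble.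
  obtain rfl | rfl | ⟨d, rfl⟩ : D = 0 ∨ D = 1 ∨ ∃ d, D = d + 3 := by
    rcases Nat.lt_or_ge D 3 with h | h
    · omega
    · exact Or.inr (Or.inr ⟨D - 3, by omega⟩)
  · have h1 : (Fintype.card V : ℝ) ≤ ∑ v, (coverCount G P v : ℝ) := by
      exact_mod_cast card_le_sum_coverCount (fun v w hvw => by
        have := (G.degree_pos_iff_exists_adj v).2 ⟨w, hvw⟩
        rw [hdeg] at this
        omega) hR
    norm_num
    linarith
  · norm_num
    linarith
  · have h1 := sum_excess_flow hdeg hR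
    have h2 : (0 : ℝ) ≤ ∑ v, (((d : ℝ) + 1) * (flowMax G P v - 1 - sumExcess G P v) +
        coverCount G P v - 1) := by exact_mod_cast h1
    simp only [Finset.sum_sub_distrib, Finset.sum_add_distrib, ← Finset.mul_sum, Finset.sum_const,
      Finset.card_univ, nsmul_eq_mul, mul_one] at h2
    have hd : (0 : ℝ) < (d : ℝ) + 1 := by positivity
    have e1 : (((d + 3 : ℕ) : ℝ) - 2) = d + 1 := by push_cast; ring
    have e2 : (((d + 3 : ℕ) : ℝ) - 1) = d + 2 := by push_cast; ring
    rw [e1, e2]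
    have e3 : ((d : ℝ) + 2) / (d + 1) * Fintype.card V + ∑ v, (sumExcess G P v : ℝ)
        - 1 / ((d : ℝ) + 1) * ∑ v, (coverCount G P v : ℝ) =
        (((d : ℝ) + 2) * Fintype.card V + (d + 1) * ∑ v, (sumExcess G P v : ℝ) -
          ∑ v, (coverCount G P v : ℝ)) / (d + 1) := by
      field_simp
    rw [e3, div_le_iff₀ hd]
    linarith

theorem excessBound_le_size [DecidableRel G.Adj] (hG : VertexTransitive G)
    (hdeg : G.maxDegree ≠ 2) (hP : Solvable G P) {t : ℕ} {U : Fin t → V → ℕ}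
    (hU : IsUnitDecomposition P U) (v : V) : excessBound G P U v ≤ size P := by
  have hR : ∀ v, 1 ≤ flowMax G P v := fun v => le_flowMax_iff.2 (KReachable.flowReach (hP v))
  have h1 := numerator_le_sum_flowMax hG.degree_eq hdeg hR
  have h2 := sum_flowMax_le (P := P) fun a => hG.effect_eq a v
  have hpos : 0 < effect G v := by
    rw [effect_eq_sum_weight]
    have := Finset.single_le_sum (fun w _ => weight_nonneg G v w) (Finset.mem_univ v)
    rw [weight_self] at this
    linarith
  have e1 : ∑ i, (cov G (U i) : ℝ) = ∑ v, (coverCount G P v : ℝ) := by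
    exact_mod_cast sum_cov_eq (G := G) hU
  rw [excessBound, div_le_iff₀ hpos, e1, unitExcess_eq_sum, Nat.cast_sum]
  exact h1.trans h2

end

end Pebbling

theorem mainTheorem5 {V : Type*} [Fintype V] (G : SimpleGraph V) [DecidableRel G.Adj]
    (hG : Pebbling.VertexTransitive G) (hdeg : G.maxDegree ≠ 2)
    (P : V → ℕ) (hP : Pebbling.Solvable G P)
    {t : ℕ} (U : Fin t → V → ℕ) (hU : Pebbling.IsUnitDecomposition P U) (v : V) :
    Pebbling.excessBound G P U v ≤ (Pebbling.size P : ℝ) ∧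
    (Pebbling.IsOptimal G P →
      Pebbling.excessBound G P U v ≤ (Pebbling.optimalPebblingNumber G : ℝ)) ∧
    (∀ (i : Fin t) (u : V), 0 < U i u →
      Pebbling.cov G (U i) =
        ∑ k ∈ Finset.range (Nat.log 2 (U i u) + 1), (Pebbling.sphere G k u).ncard) ∧
    Pebbling.unitExcess G P =
      ∑ u with 0 < P u, ∑ k ∈ Finset.range (Nat.log 2 (P u) + 1),
        (Pebbling.sphere G k u).ncard * (P u / 2 ^ k - 1) := by
  classical
  have hle := Pebbling.excessBound_le_size hG hdeg hP hU v
  refine ⟨hle, fun hopt => hle.trans ?_, fun i u hu => ?_, ?_⟩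
  · obtain ⟨Q, hQ, hsize⟩ := Nat.sInf_mem
      (s := {m | ∃ P, Pebbling.Solvable G P ∧ Pebbling.size P = m}) ⟨_, P, hP, rfl⟩
    rw [Pebbling.optimalPebblingNumber, ← hsize]
    exact_mod_cast hopt.2 Q hQ
  · have h1 := hU.eq_single hu
    have h2 : U i u = P u := by rw [h1, Pi.single_eq_same]
    rw [h2, h1]
    exact Pebbling.cov_single_eq_sum u (by omega)
  · unfold Pebbling.unitExcess
    refine Finset.sum_congr (by congr!) fun u _ => ?_
    rw [← Pebbling.totalExcess_single_eq_sum]
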